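/- **Setting.** Let $n\ge 2$ and $\ell\ge 0$ be integers, $\beta>0$ and $u\in\mathbb R$. Let $V_\ell=\{-\ell+1,\dots,\ell\}$ and $E_\ell=\{(x,x+1): -\ell+1\le x\le \ell-1\}$. Fix an orthonormal basis $(e_\alpha)_{\alpha=1}^n$ of $\mathbb C^n$. On $(\mathbb C^n)^{\otimes V_\ell}$ consider $$H_\ell=\sum_{x=-\ell+1}^{\ell-1}\bigl(-u\,T_{x,x+1}-Q_{x,x+1}\bigr),$$ where $T(\phi\otimes\varphi)=\varphi\otimes\phi$, $Q$ is the orthogonal projection onto the span of $\psi=\frac1{\sqrt n}\sum_{\alpha}e_\alpha\otimes e_\alpha$, and the subscripts denote the copies acting at the sites $x,x+1$. For $\alpha<\alpha'$ let $L^{\alpha,\alpha'}=|e_\alpha\rangle\langle e_{\alpha'}|-|e_{\alpha'}\rangle\langle e_\alpha|$, and let $L_x^{\alpha,\alpha'}$ be its copy at the site $x$. **Loops.** Let $T_\beta=(-\beta,\beta)_{\mathrm{per}}$ be the periodic time interval of length $2\beta$. A configuration $\omega\in\Omega_{\ell,\beta}$ is a finite subset of $E_\ell\times T_\beta$, each point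 of which (a *link*) is marked either as a *cross* or as a *double-bar*; $\#\omega$, $\#\omega_{\rm cross}$, $\#\omega_{\rm dbar}$ denote the numbers of links, crosses and double-bars. The loops of $\omega$ are the closed trajectories in $V_\ell\times T_\beta$ (up to orientation) that move vertically until they meet a link at one of its two endpoints, and then jump to its other endpoint, continuing in the same vertical direction at a cross and in the opposite direction at a double-bar. Let $\mathcal L(\omega)$ be their number. (This is well defined when the links occur at different times, i.e. up to a null set of configurations.) Let $\rho_u$ be the finite signed measure $$d\rho_u(\omega)=e^{-(1+u)2\beta|E_\ell|}\,u^{\#\omega_{\rm cross}}\,d^{\otimes\#\omega}x$$ on $\Omega_{\ell,\beta}$, where $d^{\otimes \#\omega}x$ is Lebesgue measure for unordered configurations of marked points: on configurations with $k$ links it is $\frac1{k!}$ times the image of the $k$-fold product of Lebesgue measure on $E_\ell\times T_\beta\times\{\text{cross},\text{double-bar}\}$. For $x,y\in V_\ell$, follow the loop that leaves $(x,0)$ through its top (upwards) until it next meets $(x,0)$ or $(y,0)$. Write $x\overset{+}{\longleftrightarrow}y$ if it then arrives at the bottom of $(y,0)$, and $x\overset{-}{\longleftrightarrow}y$ if it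 then arrives at the top of $(y,0)$. (For $x=y$, almost surely the first holds and the second does not.) **Theorem.** All integrands below are integrable with respect to $\rho_u$, and: (a) $\displaystyle \operatorname{Tr}e^{-2\beta H_\ell}=e^{2\beta(1+u)|E_\ell|}\int_{\Omega_{\ell,\beta}}d\rho_u(\omega)\,n^{\mathcal L(\omega)-\#\omega_{\rm dbar}}.$ (b) For all $1\le\alpha<\alpha'\le n$ and all $x,y\in V_\ell$, $$\operatorname{Tr}L_x^{\alpha,\alpha'}L_y^{\alpha,\alpha'}e^{-2\beta H_\ell}=\tfrac2n\,e^{2\beta(1+u)|E_\ell|}\int_{\Omega_{\ell,\beta}}d\rho_u(\omega)\,n^{\mathcal L(\omega)-\#\omega_{\rm dbar}}\bigl(\mathbf 1[x\overset{-}{\longleftrightarrow}y]-\mathbf 1[x\overset{+}{\longleftrightarrow}y]\bigr).$$ -/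

import Mathlib

open MeasureTheory
open scoped Nat ENNReal

noncomputable section

namespace SpinLoop

/-! ### The chain -/

/-- The vertices `V_ℓ = {-ℓ+1, …, ℓ}`. -/
abbrev Vertex (ℓ : ℕ) : Type := ↥(Finset.Icc (-(ℓ : ℤ) + 1) (ℓ : ℤ))

/-- The edges `E_ℓ = {(x, x+1) : -ℓ+1 ≤ x ≤ ℓ-1}`; the edge `(x, x+1)` is encoded by `x`. -/
abbrev Edge (ℓ : ℕ) : Type := ↥(Finset.Icc (-(ℓ : ℤ) + 1) ((ℓ : ℤ) - 1))

/-- The left endpoint `x` of the edge `(x, x+1)`. -/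
def Edge.left {ℓ : ℕ} (e : Edge ℓ) : Vertex ℓ :=
  ⟨e.1, by have h := Finset.mem_Icc.mp e.2; exact Finset.mem_Icc.mpr (by omega)⟩

/-- The right endpoint `x + 1` of the edge `(x, x+1)`. -/
def Edge.right {ℓ : ℕ} (e : Edge ℓ) : Vertex ℓ :=
  ⟨e.1 + 1, by have h := Finset.mem_Icc.mp e.2; exact Finset.mem_Icc.mpr (by omega)⟩

/-! ### The quantum spin chain

The Hilbert space is `(ℂⁿ)^{⊗ V_ℓ}`. Operators on it are written as matrices in the product basis
`e_σ = ⨂_x e_{σ x}`, indexed by `σ : V_ℓ → Fin n`, where `(e_α)` is the fixed orthonormal basis of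
`ℂⁿ`. Likewise, operators on `ℂⁿ ⊗ ℂⁿ` are matrices indexed by `Fin n × Fin n`. -/

/-- Operators on `(ℂⁿ)^{⊗ V_ℓ}`. -/
abbrev Operator (n ℓ : ℕ) : Type := Matrix (Vertex ℓ → Fin n) (Vertex ℓ → Fin n) ℂ

/-- The transposition operator, `T (φ ⊗ χ) = χ ⊗ φ`. -/
def transposition (n : ℕ) : Matrix (Fin n × Fin n) (Fin n × Fin n) ℂ :=
  Matrix.of fun p q => if p = q.swap then 1 else 0

/-- The unit vector `ψ = n^{-1/2} ∑_α e_α ⊗ e_α`. -/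
def psi (n : ℕ) : Fin n × Fin n → ℂ :=
  fun p => if p.1 = p.2 then ((1 / Real.sqrt n : ℝ) : ℂ) else 0

/-- The orthogonal projection `Q = |ψ⟩⟨ψ|`. -/
def projQ (n : ℕ) : Matrix (Fin n × Fin n) (Fin n × Fin n) ℂ :=
  Matrix.vecMulVec (psi n) (star (psi n))

/-- The generator `L^{α,α'} = |α⟩⟨α'| - |α'⟩⟨α|` of `𝔬(n)`. -/
def generator {n : ℕ} (α α' : Fin n) : Matrix (Fin n) (Fin n) ℂ :=
  Matrix.single α α' 1 - Matrix.single α' α 1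

/-- The copy of the one-site operator `A` that acts at `x`, and as the identity elsewhere. -/
def atSite {n ℓ : ℕ} (A : Matrix (Fin n) (Fin n) ℂ) (x : Vertex ℓ) : Operator n ℓ :=
  Matrix.of fun σ τ => if ∀ z, z ≠ x → σ z = τ z then A (σ x) (τ x) else 0

/-- The copy of the two-site operator `h` that acts at the pair `(x, y)`, and as the identity
elsewhere. -/
def atPair {n ℓ : ℕ} (h : Matrix (Fin n × Fin n) (Fin n × Fin n) ℂ) (x y : Vertex ℓ) :
    Operator n ℓ :=
  Matrix.of fun σ τ =>
    if ∀ z, z ≠ x → z ≠ y → σ z = τ z then h (σ x, σ y) (τ x, τ y) else 0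

/-- The interaction `h = -u T - Q`. -/
def interaction (n : ℕ) (u : ℝ) : Matrix (Fin n × Fin n) (Fin n × Fin n) ℂ :=
  -((u : ℂ) • transposition n) - projQ n

/-- The Hamiltonian `H_ℓ = ∑_{x=-ℓ+1}^{ℓ-1} h_{x,x+1}` with `h = -u T - Q`. -/
def hamiltonian (n ℓ : ℕ) (u : ℝ) : Operator n ℓ :=
  ∑ e : Edge ℓ, atPair (interaction n u) e.left e.right

/-! ### Link configurations -/

/-- The time interval `(-β, β)`, which is thought of as periodic; it carries Lebesgue measure. -/
abbrev Time (β : ℝ) : Type := ↥(Set.Ioo (-β) β)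

/-- The space-time edges `E_ℓ × T_β`. -/
abbrev SpaceTimeEdge (ℓ : ℕ) (β : ℝ) : Type := Edge ℓ × Time β

/-- The marks of links: cross or double-bar. -/
inductive Mark : Type
  | cross
  | dbar
  deriving DecidableEq

instance : Fintype Mark := ⟨{Mark.cross, Mark.dbar}, fun m => by cases m <;> simp⟩

instance : MeasurableSpace Mark := ⊤

/-- A link: a point of `E_ℓ × T_β` together with its mark. -/
abbrev Link (ℓ : ℕ) (β : ℝ) : Type := SpaceTimeEdge ℓ β × Mark

/-- The link `l` has `x` as one of its two endpoints. -/
def Link.Touches {ℓ : ℕ} {β : ℝ} (l : Link ℓ β) (x : Vertex ℓ) : Prop :=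
  l.1.1.left = x ∨ l.1.1.right = x

/-- A configuration: a finite subset of `E_ℓ × T_β`, each point of which receives exactly one
mark. -/
@[ext]
structure Config (ℓ : ℕ) (β : ℝ) : Type where
  links : Finset (Link ℓ β)
  unique_mark : Set.InjOn Prod.fst (links : Set (Link ℓ β))

/-- The number of crosses of a configuration. -/
def Config.numCross {ℓ : ℕ} {β : ℝ} (ω : Config ℓ β) : ℕ :=
  (ω.links.filter fun l => l.2 = Mark.cross).card

/-- The number of double-bars of a configuration. -/
def Config.numDbar {ℓ : ℕ} {β : ℝ} (ω : Config ℓ β) : ℕ :=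
  (ω.links.filter fun l => l.2 = Mark.dbar).card

/-! ### The measures on configurations -/

/-- The `k`-tuples of marked points of `E_ℓ × T_β` at pairwise different positions. -/
abbrev LinkTuple (ℓ : ℕ) (β : ℝ) (k : ℕ) : Type :=
  {v : Fin k → Link ℓ β // Function.Injective fun i => (v i).1}

/-- The configuration that consists of the entries of a tuple. -/
def LinkTuple.toConfig {ℓ : ℕ} {β : ℝ} {k : ℕ} (v : LinkTuple ℓ β k) : Config ℓ β where
  links := Finset.univ.map ⟨v.1, fun _ _ h => v.2 (congrArg Prod.fst h)⟩
  unique_mark := by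
    intro a ha b hb hab
    simp only [Finset.coe_map, Set.mem_image] at ha hb
    obtain ⟨i, -, rfl⟩ := ha
    obtain ⟨j, -, rfl⟩ := hb
    exact congrArg v.1 (v.2 hab)

/-- A set of configurations is measurable when, for each `k`, the set of `k`-tuples that
enumerate one of its members is measurable. -/
instance (ℓ : ℕ) (β : ℝ) : MeasurableSpace (Config ℓ β) :=
  ⨅ k : ℕ, MeasurableSpace.map (LinkTuple.toConfig (k := k)) inferInstance

theorem LinkTuple.measurable_toConfig {ℓ : ℕ} {β : ℝ} {k : ℕ} :
    Measurable (LinkTuple.toConfig : LinkTuple ℓ β k → Config ℓ β) := by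
  intro s hs
  exact (MeasurableSpace.measurableSet_iInf.mp hs) k

/-- Lebesgue measure on `E_ℓ × T_β` (the sum over the edges of Lebesgue measure on `T_β`), for each
of the two marks. -/
def linkMeasure (ℓ : ℕ) (β : ℝ) : Measure (Link ℓ β) :=
  ((Measure.count : Measure (Edge ℓ)).prod
      (Measure.comap (Subtype.val : Time β → ℝ) volume)).prod
    (Measure.count : Measure Mark)

/-- The measure `d^{⊗ #ω} x` on configurations: its part on configurations with `k` links is `1/k!`
times the image of the `k`-fold product measure, so that each unordered configuration is counted
once. -/
def configMeasure (ℓ : ℕ) (β : ℝ) : Measure (Config ℓ β) :=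
  Measure.sum fun k : ℕ => ((k ! : ℝ≥0∞)⁻¹) •
    Measure.map LinkTuple.toConfig
      (Measure.comap (Subtype.val : LinkTuple ℓ β k → (Fin k → Link ℓ β))
        (Measure.pi fun _ => linkMeasure ℓ β))

/-- The signed measure `dρ̄_u(ω) = u^{#crosses} d^{⊗ #ω} x`. -/
def rhoBar (ℓ : ℕ) (β u : ℝ) : SignedMeasure (Config ℓ β) :=
  (configMeasure ℓ β).withDensityᵥ fun ω => u ^ ω.numCross

/-- The normalised signed measure `dρ_u(ω) = e^{-(1+u) 2β |E_ℓ|} dρ̄_u(ω)`. -/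
def rho (ℓ : ℕ) (β u : ℝ) : SignedMeasure (Config ℓ β) :=
  Real.exp (-((1 + u) * (2 * β) * Fintype.card (Edge ℓ))) • rhoBar ℓ β u

/-! ### Loops -/

/-- The two sides of a space-time vertex `(x, t)`: its bottom `(x, t-)` and its top `(x, t+)`. -/
inductive Side : Type
  | bottom
  | top

/-- The bottoms and tops of the space-time vertices. -/
abbrev End (ℓ : ℕ) (β : ℝ) : Type := Vertex ℓ × Time β × Side

/-- `Between t t' s`: the time `s` is met strictly between `t` and `t'` when moving upwards from `t`
to `t'` in the periodic interval `T_β`; if `t' = t` the move is a full turn. -/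
def Between {β : ℝ} (t t' s : Time β) : Prop :=
  if t < t' then t < s ∧ s < t' else t < s ∨ s < t'

/-- The elementary moves along the loops of `ω`, when the loops are cut open at the space-time
vertices in `C`.
* `vertical`: the top of `(x, t)` is connected to the bottom of `(x, t')` if no link and no cut
  is met in between.
* `through`: the bottom and the top of `(x, t)` are connected if there is no link and no cut there.
* `cross_left`, `cross_right`: at a cross, a trajectory jumps to the other endpoint of the link and
  keeps its vertical direction.
* `dbar_bottom`, `dbar_top`: at a double-bar, a trajectory jumps to the other endpoint of the link
  and reverses its vertical direction. -/
inductive Joined {ℓ : ℕ} {β : ℝ} (ω : Config ℓ β) (C : Set (Vertex ℓ × Time β)) :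
    End ℓ β → End ℓ β → Prop
  | vertical (x : Vertex ℓ) (t t' : Time β)
      (hC : ∀ s, (x, s) ∈ C → ¬ Between t t' s)
      (h : ∀ l ∈ ω.links, Link.Touches l x → ¬ Between t t' l.1.2) :
      Joined ω C (x, t, Side.top) (x, t', Side.bottom)
  | through (x : Vertex ℓ) (t : Time β) (hC : (x, t) ∉ C)
      (h : ∀ l ∈ ω.links, Link.Touches l x → l.1.2 ≠ t) :
      Joined ω C (x, t, Side.bottom) (x, t, Side.top)
  | cross_left (e : Edge ℓ) (t : Time β) (h : ((e, t), Mark.cross) ∈ ω.links) :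
      Joined ω C (e.left, t, Side.bottom) (e.right, t, Side.top)
  | cross_right (e : Edge ℓ) (t : Time β) (h : ((e, t), Mark.cross) ∈ ω.links) :
      Joined ω C (e.right, t, Side.bottom) (e.left, t, Side.top)
  | dbar_bottom (e : Edge ℓ) (t : Time β) (h : ((e, t), Mark.dbar) ∈ ω.links) :
      Joined ω C (e.left, t, Side.bottom) (e.right, t, Side.bottom)
  | dbar_top (e : Edge ℓ) (t : Time β) (h : ((e, t), Mark.dbar) ∈ ω.links) :
      Joined ω C (e.left, t, Side.top) (e.right, t, Side.top)

/-- The loops of `ω`: the classes of the equivalence relation generated by the elementary moves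
(without any cuts). Traversing such a class gives the closed trajectory, up to orientation. -/
def Config.Loop {ℓ : ℕ} {β : ℝ} (ω : Config ℓ β) : Type := Quot (Joined ω ∅)

/-- The number `𝓛(ω)` of loops. -/
def Config.numLoops {ℓ : ℕ} {β : ℝ} (ω : Config ℓ β) : ℕ := Nat.card ω.Loop

/-- The ends `a` and `b` are connected by a piece of a loop of `ω` that does not pass through any of
the space-time vertices in `C`. -/
def Config.ConnectedOff {ℓ : ℕ} {β : ℝ} (ω : Config ℓ β) (C : Set (Vertex ℓ × Time β))
    (a b : End ℓ β) : Prop :=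
  Relation.EqvGen (Joined ω C) a b

/-- The event `x ⟷⁺ y` (at time `t`): the loop that leaves `(x, t)` through its top next meets
`{(x, t), (y, t)}` at the bottom of `(y, t)`. If `x = y`, this almost surely happens. -/
def plusConnected {ℓ : ℕ} {β : ℝ} (t : Time β) (x y : Vertex ℓ) : Set (Config ℓ β) :=
  {ω | ω.ConnectedOff {(x, t), (y, t)} (x, t, Side.top) (y, t, Side.bottom)}

/-- The event `x ⟷⁻ y` (at time `t`): the loop that leaves `(x, t)` through its top next meets
`{(x, t), (y, t)}` at the top of `(y, t)`. If `x = y`, this never happens: the loop comes back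
through the bottom. -/
def minusConnected {ℓ : ℕ} {β : ℝ} (t : Time β) (x y : Vertex ℓ) : Set (Config ℓ β) :=
  {ω | x ≠ y ∧ ω.ConnectedOff {(x, t), (y, t)} (x, t, Side.top) (y, t, Side.top)}

/-- The loop weight `n^{𝓛(ω) - #double-bars}`. -/
def loopWeight (n : ℕ) {ℓ : ℕ} {β : ℝ} (ω : Config ℓ β) : ℝ :=
  (n : ℝ) ^ ((ω.numLoops : ℤ) - (ω.numDbar : ℤ))

/-- The loop partition function `Z_{ℓ,β,n,u} = ∫ dρ_u(ω) n^{𝓛(ω) - #double-bars}`. -/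
def partitionFunction (ℓ : ℕ) (β : ℝ) (n : ℕ) (u : ℝ) : ℝ :=
  ∫ᵛ ω, loopWeight n ω ∂<•(rho ℓ β u)

/-- The integrand `n^{𝓛(ω) - #double-bars} (1[x ⟷⁻ y] - 1[x ⟷⁺ y])` of the two-point function, with
the connections at time `t`. -/
def twoPointWeight (n : ℕ) {ℓ : ℕ} {β : ℝ} (t : Time β) (x y : Vertex ℓ) (ω : Config ℓ β) : ℝ :=
  loopWeight n ω *
    ((minusConnected t x y).indicator 1 ω - (plusConnected t x y).indicator 1 ω)

end SpinLoop

end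

open SpinLoop

/-!
The operator `-H_ℓ` is the sum over the edges of `u T + Q`, that is, a combination of one operator
for each type of link: `T` with coefficient `u` for a cross, and `n Q` with coefficient `1 / n`
for a double-bar. In the product basis these operators have entries `0` and `1` (`linkOperator`).
Expanding the exponential series and the matrix products gives a sum over `k`, over sequences `s`
of `k` link types, and over paths of `k + 1` spin configurations (`hasSum_trace_mul_exp`,
`trace_mul_pow_sum`). The product of the entries of the link operators is `1` exactly at the paths
that are constant along the loops, so that the sum over paths counts the colourings of the loops
with `n` colours (`sum_path_eq_sum_colouring`); for the partition function this number is `n` to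
the number of loops.

Almost every configuration has its links at different times that are not `0`, and its loops only
depend on the types `s` of its links in the order in which they are met on the way upwards from
time `0`: they are the components of the graph `LevelJoined s`, whose vertices are the sites at
the times between consecutive links (`loopEquiv`). For fixed times, the sum over the types of the
links does not depend on the order of the times, so that the integral over configurations of such
a function is `∑ k, (2β)^k / k! ∑ s` of its values (`HasOrderedValue.hasSum_integral`), which is
the series obtained for the trace.

For the two-point function the loops are cut at `(x, 0)` and `(y, 0)`. A set of pieces visits two
consecutive levels in the same number of sites modulo `2` (`sum_parity_level`); hence the four
ends at the cuts lie pairwise on common pieces (`piece_pairing`). According to the pairing, the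
sum of the product of the two generator entries over the colourings is `0`, `-2 / n` or `2 / n`
times the number of colourings of the loops (`sum_generator_mul_generator`), as `L^{α,α'}` is
antisymmetric with two entries `±1`. The case that all four ends lie on one piece does not have to
be excluded: both sides vanish there.
-/
noncomputable section

namespace SpinLoop

/-! ### Integrals with respect to signed measures with a density -/

theorem integrable_smul_withDensityᵥ {X : Type*} [MeasurableSpace X] {μ : Measure X}
    {f w : X → ℝ} (c : ℝ) (hf : AEStronglyMeasurable f μ) (hw : Integrable w μ)
    (hfw : Integrable (fun x => f x * w x) μ) :
    (c • μ.withDensityᵥ w).Integrable f := by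
  refine VectorMeasure.Integrable.smul_vectorMeasure ?_ c
  rw [VectorMeasure.Integrable, Measure.variation_withDensityᵥ hw,
    integrable_withDensity_iff_integrable_smul₀' hw.1.aemeasurable.enorm (by simp)]
  refine hfw.norm.congr' ?_ ?_
  · exact hw.1.aemeasurable.enorm.ennreal_toReal.aestronglyMeasurable.smul hf
  · filter_upwards with x
    simp [mul_comm]

theorem integral_smul_withDensityᵥ {X : Type*} [MeasurableSpace X] {μ : Measure X}
    {f w : X → ℝ} (c : ℝ) (hf : AEStronglyMeasurable f μ) (hw : Integrable w μ)
    (hfw : Integrable (fun x => f x * w x) μ) :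
    ∫ᵛ x, f x ∂<•(c • μ.withDensityᵥ w) = c * ∫ x, f x * w x ∂μ := by
  have hbound (v : X → ℝ) (x : X) : ‖f x * max (v x) 0‖ ≤ ‖f x * v x‖ := by
    rw [norm_mul, norm_mul, Real.norm_eq_abs (max _ _), abs_of_nonneg (le_max_right _ _)]
    gcongr
    exact max_le (le_abs_self _) (abs_nonneg _)
  have hpart {v : X → ℝ} (hv : Integrable v μ) (hfv : Integrable (fun x => f x * v x) μ) :
      Integrable (fun x => f x * max (v x) 0) μ ∧
      Integrable f (μ.withDensity fun x => ENNReal.ofReal (v x)) ∧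
      ∫ x, f x ∂(μ.withDensity fun x => ENNReal.ofReal (v x)) = ∫ x, f x * max (v x) 0 ∂μ := by
    have hi : Integrable (fun x => f x * max (v x) 0) μ :=
      hfv.norm.mono' (hf.mul (hv.1.sup aestronglyMeasurable_const)) (.of_forall (hbound v))
    refine ⟨hi, ?_, ?_⟩
    · rw [integrable_withDensity_iff_integrable_smul₀' hv.1.aemeasurable.ennreal_ofReal (by simp)]
      simpa only [ENNReal.toReal_ofReal', smul_eq_mul, mul_comm] using hi
    · rw [integral_withDensity_eq_integral_toReal_smul₀ hv.1.aemeasurable.ennreal_ofReal (by simp)]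
      simp only [ENNReal.toReal_ofReal', smul_eq_mul, mul_comm]
  have := isFiniteMeasure_withDensity_ofReal hw.2
  have := isFiniteMeasure_withDensity_ofReal hw.neg.2
  obtain ⟨hi, h1, h2⟩ := hpart hw hfw
  obtain ⟨hi', h1', h2'⟩ := hpart hw.neg (by simpa using hfw.neg)
  simp only [Pi.neg_apply] at hi' h1' h2'
  rw [VectorMeasure.integral_smul_vectorMeasure,
    withDensityᵥ_eq_withDensity_pos_part_sub_withDensity_neg_part hw,
    VectorMeasure.integral_sub_vectorMeasure (by simpa [VectorMeasure.Integrable] using h1)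
      (by simpa [VectorMeasure.Integrable] using h1'),
    VectorMeasure.integral_toSignedMeasure, VectorMeasure.integral_toSignedMeasure, h2, h2',
    smul_eq_mul, ← integral_sub hi hi']
  congr 2 with x
  rw [← mul_sub]
  exact congrArg (f x * ·) (posPart_sub_negPart (w x))

/-! ### Ordered configurations and their level graph -/

/-- The type of a link: its edge and its mark, without its time. -/
abbrev LinkType (ℓ : ℕ) : Type := Edge ℓ × Mark

/-- The projection of a link to its type. -/
def Link.type {ℓ : ℕ} {β : ℝ} (l : Link ℓ β) : LinkType ℓ := (l.1.1, l.2)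

/-- The time elapsed on the way upwards from time `0` to `t`, in `[0, 2β)`. -/
def upKey {β : ℝ} (t : Time β) : ℝ := if 0 ≤ t.1 then t.1 else t.1 + 2 * β

/-- The time elapsed on the way upwards from just above time `0` to `t`, in `(0, 2β]`. It differs
from `upKey` at `t = 0` only. -/
def downKey {β : ℝ} (t : Time β) : ℝ := if 0 < t.1 then t.1 else t.1 + 2 * β

/-- The links are listed in the order in which they are met when moving upwards from time `0`, and
none of them sits at time `0`. -/
structure InOrder {ℓ : ℕ} {β : ℝ} {k : ℕ} (v : Fin k → Link ℓ β) : Prop where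
  strictMono : StrictMono fun i => upKey (v i).1.2
  ne_zero : ∀ i, (v i).1.2.1 ≠ 0

/-- The graph of the loops of `k` links of types `s`, met in this order: the vertex `(z, j)` is the
site `z` at the times between the `j`-th link and the next one, and level `k` is followed by level
`0` at time `0`, except at the sites in `C`, where the loops are cut. -/
inductive LevelJoined {ℓ k : ℕ} (s : Fin k → LinkType ℓ) (C : Set (Vertex ℓ)) :
    Vertex ℓ × Fin (k + 1) → Vertex ℓ × Fin (k + 1) → Prop
  | straight (i : Fin k) (z : Vertex ℓ) (hl : z ≠ (s i).1.left) (hr : z ≠ (s i).1.right) :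
      LevelJoined s C (z, i.castSucc) (z, i.succ)
  | cross_left (i : Fin k) (h : (s i).2 = Mark.cross) :
      LevelJoined s C ((s i).1.left, i.castSucc) ((s i).1.right, i.succ)
  | cross_right (i : Fin k) (h : (s i).2 = Mark.cross) :
      LevelJoined s C ((s i).1.right, i.castSucc) ((s i).1.left, i.succ)
  | dbar_bottom (i : Fin k) (h : (s i).2 = Mark.dbar) :
      LevelJoined s C ((s i).1.left, i.castSucc) ((s i).1.right, i.castSucc)
  | dbar_top (i : Fin k) (h : (s i).2 = Mark.dbar) :
      LevelJoined s C ((s i).1.left, i.succ) ((s i).1.right, i.succ)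
  | close (z : Vertex ℓ) (hz : z ∉ C) : LevelJoined s C (z, Fin.last k) (z, 0)

theorem downKey_pos {β : ℝ} (t : Time β) : 0 < downKey t := by
  have := t.2.1; have := t.2.2
  unfold downKey; split_ifs <;> linarith

theorem upKey_injective {β : ℝ} : Function.Injective (upKey (β := β)) := by
  intro t s h
  have := t.2.1; have := t.2.2; have := s.2.1; have := s.2.2
  unfold upKey at h
  apply Subtype.ext
  split_ifs at h <;> linarith

theorem downKey_eq_upKey {β : ℝ} {t : Time β} (h : t.1 ≠ 0) : downKey t = upKey t := by
  unfold downKey upKey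
  rcases lt_or_gt_of_ne h with h | h
  · rw [if_neg (by linarith), if_neg (by linarith)]
  · rw [if_pos h, if_pos h.le]

theorem upKey_lt_downKey_of_eq_zero {β : ℝ} (s : Time β) {t : Time β} (h : t.1 = 0) :
    upKey s < downKey t := by
  have := s.2.1; have := s.2.2
  unfold downKey upKey
  rw [h]
  split_ifs <;> linarith

theorem upKey_eq_zero {β : ℝ} {t : Time β} (h : t.1 = 0) : upKey t = 0 := by
  simp [upKey, h]

theorem upKey_pos {β : ℝ} {t : Time β} (h : t.1 ≠ 0) : 0 < upKey t := by
  rw [← downKey_eq_upKey h]; exact downKey_pos t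

/-- Cyclic betweenness in terms of the time elapsed since time `0`: a move from `t` up to `t'` that
does not satisfy `upKey t < downKey t'` wraps around through time `0`. -/
theorem between_iff {β : ℝ} (t t' : Time β) {s : Time β} (hs : s.1 ≠ 0) :
    Between t t' s ↔ if upKey t < downKey t' then upKey t < upKey s ∧ upKey s < downKey t'
      else upKey t < upKey s ∨ upKey s < downKey t' := by
  obtain ⟨t, ht⟩ := t
  obtain ⟨t', ht'⟩ := t'
  obtain ⟨s, hs'⟩ := s
  simp only [Set.mem_Ioo] at ht ht' hs'
  simp only [Between, upKey, downKey, Subtype.mk_lt_mk]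
  simp only at hs
  rcases lt_or_gt_of_ne hs with hs | hs <;> split_ifs <;> grind

/-- Time `0` is met by the moves that wrap around only, and by no move that starts or ends there. -/
theorem between_zero_iff {β : ℝ} (t t' : Time β) {s : Time β} (hs : s.1 = 0) :
    Between t t' s ↔ downKey t' ≤ upKey t := by
  obtain ⟨t, ht⟩ := t
  obtain ⟨t', ht'⟩ := t'
  obtain ⟨s, hs'⟩ := s
  simp only [Set.mem_Ioo] at ht ht' hs'
  simp only at hs
  subst hs
  simp only [Between, upKey, downKey, Subtype.mk_lt_mk]
  split_ifs <;> grind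

/-! ### Levels -/

section Levels

variable {ℓ : ℕ} {β : ℝ} {k : ℕ} (v : Fin k → Link ℓ β)

/-- The number of links met on the way upwards from just above time `0` to the bottom of time `t`;
at `t = 0` this is a full turn. -/
def downLevel (t : Time β) : Fin (k + 1) :=
  ⟨(Finset.univ.filter fun i => upKey (v i).1.2 < downKey t).card,
    Nat.lt_succ_of_le ((Finset.card_le_univ _).trans_eq (Fintype.card_fin k))⟩

/-- The number of links met on the way upwards from time `0` to the top of time `t`. -/
def upLevel (t : Time β) : Fin (k + 1) :=
  ⟨(Finset.univ.filter fun i => upKey (v i).1.2 ≤ upKey t).card,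
    Nat.lt_succ_of_le ((Finset.card_le_univ _).trans_eq (Fintype.card_fin k))⟩

/-- An initial segment of `Fin k` consists of the elements below its cardinality. -/
theorem lt_card_filter_iff (p : Fin k → Prop) [DecidablePred p]
    (hp : ∀ i j, i ≤ j → p j → p i) (i : Fin k) : i.1 < (Finset.univ.filter p).card ↔ p i := by
  constructor
  · intro h
    by_contra hi
    have : (Finset.univ.filter p) ⊆ Finset.Iio i := by
      intro j hj
      rw [Finset.mem_Iio]
      by_contra hij
      exact hi (hp i j (not_lt.mp hij) (Finset.mem_filter.mp hj).2)
    have := Finset.card_le_card this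
    rw [Fin.card_Iio] at this
    omega
  · intro hi
    have : Finset.Iic i ⊆ (Finset.univ.filter p) := by
      intro j hj
      exact Finset.mem_filter.mpr ⟨Finset.mem_univ _, hp j i (Finset.mem_Iic.mp hj) hi⟩
    have := Finset.card_le_card this
    rw [Fin.card_Iic] at this
    omega

variable {v} (hv : InOrder v)
include hv

theorem lt_downLevel_iff (t : Time β) (i : Fin k) :
    i.castSucc < downLevel v t ↔ upKey (v i).1.2 < downKey t := by
  rw [Fin.lt_def]
  exact lt_card_filter_iff (fun i => upKey (v i).1.2 < downKey t)
    (fun i j hij h => (hv.strictMono.monotone hij).trans_lt h) i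

theorem lt_upLevel_iff (t : Time β) (i : Fin k) :
    i.castSucc < upLevel v t ↔ upKey (v i).1.2 ≤ upKey t := by
  rw [Fin.lt_def]
  exact lt_card_filter_iff (fun i => upKey (v i).1.2 ≤ upKey t)
    (fun i j hij h => (hv.strictMono.monotone hij).trans h) i

theorem downLevel_eq (t : Time β) (j : Fin (k + 1))
    (h : ∀ i : Fin k, upKey (v i).1.2 < downKey t ↔ i.castSucc < j) : downLevel v t = j := by
  have h' : ∀ i : Fin k, i.castSucc < downLevel v t ↔ i.castSucc < j := fun i => by
    rw [lt_downLevel_iff hv, h]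
  have h1 := (downLevel v t).2
  have h2 := j.2
  simp only [Fin.lt_def, Fin.val_castSucc] at h'
  apply Fin.ext
  rcases lt_trichotomy (downLevel v t).1 j.1 with hlt | heq | hlt
  · have := h' ⟨(downLevel v t).1, by omega⟩; simp at this; omega
  · exact heq
  · have := h' ⟨j.1, by omega⟩; simp at this; omega

theorem upLevel_eq (t : Time β) (j : Fin (k + 1))
    (h : ∀ i : Fin k, upKey (v i).1.2 ≤ upKey t ↔ i.castSucc < j) : upLevel v t = j := by
  have h' : ∀ i : Fin k, i.castSucc < upLevel v t ↔ i.castSucc < j := fun i => by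
    rw [lt_upLevel_iff hv, h]
  have h1 := (upLevel v t).2
  have h2 := j.2
  simp only [Fin.lt_def, Fin.val_castSucc] at h'
  apply Fin.ext
  rcases lt_trichotomy (upLevel v t).1 j.1 with hlt | heq | hlt
  · have := h' ⟨(upLevel v t).1, by omega⟩; simp at this; omega
  · exact heq
  · have := h' ⟨j.1, by omega⟩; simp at this; omega

theorem downLevel_link (i : Fin k) : downLevel v (v i).1.2 = i.castSucc := by
  refine downLevel_eq hv _ _ fun j => ?_
  rw [downKey_eq_upKey (hv.ne_zero i), hv.strictMono.lt_iff_lt, Fin.castSucc_lt_castSucc_iff]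

theorem upLevel_link (i : Fin k) : upLevel v (v i).1.2 = i.succ := by
  refine upLevel_eq hv _ _ fun j => ?_
  rw [hv.strictMono.le_iff_le, Fin.castSucc_lt_succ_iff]

theorem downLevel_zero {t : Time β} (ht : t.1 = 0) : downLevel v t = Fin.last k := by
  refine downLevel_eq hv _ _ fun j => ?_
  simp [upKey_lt_downKey_of_eq_zero _ ht, Fin.castSucc_lt_last]

theorem upLevel_zero {t : Time β} (ht : t.1 = 0) : upLevel v t = 0 := by
  refine upLevel_eq hv _ _ fun j => ?_
  simp [upKey_eq_zero ht, upKey_pos (hv.ne_zero j)]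

end Levels

open Relation (EqvGen)

/-- Levels `a ≤ b` are joined at a site that no link in between touches. -/
theorem eqvGen_levelJoined_of_le {ℓ k : ℕ} {s : Fin k → LinkType ℓ} {C : Set (Vertex ℓ)}
    {z : Vertex ℓ} {a b : Fin (k + 1)} (hab : a ≤ b)
    (h : ∀ i : Fin k, a ≤ i.castSucc → i.castSucc < b → z ≠ (s i).1.left ∧ z ≠ (s i).1.right) :
    EqvGen (LevelJoined s C) (z, a) (z, b) := by
  induction b using Fin.induction with
  | zero => rw [Fin.le_zero_iff.mp hab]; exact .refl _
  | succ i ih =>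
    rcases hab.eq_or_lt with rfl | hlt
    · exact .refl _
    · have hai : a ≤ i.castSucc := Fin.le_castSucc_iff.mpr hlt
      refine .trans _ _ _ (ih hai fun j h1 h2 => h j h1 (h2.trans (Fin.castSucc_lt_succ))) ?_
      have := h i hai Fin.castSucc_lt_succ
      exact .rel _ _ (.straight i z this.1 this.2)

section

-- `C` is the set of sites at which the loops are cut at time `0`.
variable {ℓ : ℕ} {β : ℝ} {k : ℕ} {v : LinkTuple ℓ β k} (hv : InOrder v.1)
  {C : Set (Vertex ℓ)} {D : Set (Vertex ℓ × Time β)} (hD : ∀ p, p ∈ D ↔ p.1 ∈ C ∧ p.2.1 = 0)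

theorem LinkTuple.mem_toConfig {ℓ : ℕ} {β : ℝ} {k : ℕ} {v : LinkTuple ℓ β k} {l : Link ℓ β} :
    l ∈ v.toConfig.links ↔ ∃ i, v.1 i = l := by
  simp only [LinkTuple.toConfig, Finset.mem_map, Finset.mem_univ, true_and]
  rfl

/-- The types of the links of a tuple. -/
abbrev types {ℓ : ℕ} {β : ℝ} {k : ℕ} (v : Fin k → Link ℓ β) : Fin k → LinkType ℓ :=
  fun i => (v i).type

/-- The level at which an end of a space-time vertex sits. -/
def toLevel {ℓ : ℕ} {β : ℝ} {k : ℕ} (v : Fin k → Link ℓ β) : End ℓ β → Vertex ℓ × Fin (k + 1)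
  | (x, t, Side.top) => (x, upLevel v t)
  | (x, t, Side.bottom) => (x, downLevel v t)

/-- The time at which a level begins; `t₀` is time `0`. -/
def levelTime {ℓ : ℕ} {β : ℝ} {k : ℕ} (v : Fin k → Link ℓ β) (t₀ : Time β) :
    Fin (k + 1) → Time β :=
  Fin.cons t₀ fun i => (v i).1.2

/-- The lowest end of a level. -/
def ofLevel {ℓ : ℕ} {β : ℝ} {k : ℕ} (v : Fin k → Link ℓ β) (t₀ : Time β)
    (p : Vertex ℓ × Fin (k + 1)) : End ℓ β :=
  (p.1, levelTime v t₀ p.2, Side.top)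

theorem not_touches_iff {i : Fin k} {z : Vertex ℓ} : ¬ Link.Touches (v.1 i) z ↔
    z ≠ (types v.1 i).1.left ∧ z ≠ (types v.1 i).1.right := by
  simp only [Link.Touches, Link.type, not_or, ne_eq, eq_comm]

include hv

include hD in
/-- Each elementary move along a loop is a walk in the level graph. -/
theorem eqvGen_levelJoined_of_joined {a b : End ℓ β} (h : Joined v.toConfig D a b) :
    EqvGen (LevelJoined (types v.1) C) (toLevel v.1 a) (toLevel v.1 b) := by
  cases h with
  | vertical x t t' hC h =>
    have h' : ∀ i, Between t t' (v.1 i).1.2 →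
        x ≠ (types v.1 i).1.left ∧ x ≠ (types v.1 i).1.right := by
      intro i hi
      rw [← not_touches_iff]
      exact fun ht => h _ (LinkTuple.mem_toConfig.mpr ⟨i, rfl⟩) ht hi
    simp only [toLevel]
    -- If the move does not wrap around, its links are those at the levels from `t` to `t'`.
    -- Otherwise it consists of a walk up to the last level, the passage through time `0`, and a
    -- walk up from level `0`.
    by_cases hlt : upKey t < downKey t'
    · refine eqvGen_levelJoined_of_le ?_ fun i h1 h2 => h' i ?_
      · rw [← not_lt]
        intro hl
        have hl' : (downLevel v.1 t').1 < k :=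
          lt_of_lt_of_le hl (Nat.le_of_lt_succ (upLevel v.1 t).2)
        have e : (⟨_, hl'⟩ : Fin k).castSucc = downLevel v.1 t' := rfl
        rw [← e, lt_upLevel_iff hv] at hl
        have := (lt_downLevel_iff hv t' ⟨_, hl'⟩).not.mp (by rw [e]; exact lt_irrefl _)
        exact this (hl.trans_lt hlt)
      · rw [between_iff _ _ (hv.ne_zero i), if_pos hlt, ← lt_downLevel_iff hv, ← not_le,
          ← lt_upLevel_iff hv, not_lt]
        exact ⟨h1, h2⟩
    · refine .trans _ (x, Fin.last k) _ (eqvGen_levelJoined_of_le (Fin.le_last _)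
        fun i h1 h2 => h' i ?_) (.trans _ (x, 0) _ (.rel _ _ (.close x fun hx => ?_))
        (eqvGen_levelJoined_of_le (Fin.zero_le _) fun i h1 h2 => h' i ?_))
      · rw [between_iff _ _ (hv.ne_zero i), if_neg hlt, ← not_le, ← lt_upLevel_iff hv, not_lt]
        exact Or.inl h1
      · have h0 : -β < 0 ∧ 0 < β := by
          have := t.2.1; have := t.2.2; constructor <;> linarith
        exact hC ⟨0, h0⟩ ((hD _).mpr ⟨hx, rfl⟩) ((between_zero_iff t t' rfl).mpr (not_lt.mp hlt))
      · rw [between_iff _ _ (hv.ne_zero i), if_neg hlt, ← lt_downLevel_iff hv]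
        exact Or.inr h2
  | through x t hC h =>
    simp only [toLevel]
    by_cases ht : t.1 = 0
    · rw [upLevel_zero hv ht, downLevel_zero hv ht]
      exact .rel _ _ (.close x fun hx => hC ((hD _).mpr ⟨hx, ht⟩))
    · refine eqvGen_levelJoined_of_le ?_ fun i h1 h2 => ?_
      · rw [← not_lt]
        intro hl
        have hl' : (upLevel v.1 t).1 < k :=
          lt_of_lt_of_le hl (Nat.le_of_lt_succ (downLevel v.1 t).2)
        have e : (⟨_, hl'⟩ : Fin k).castSucc = upLevel v.1 t := rfl
        rw [← e, lt_downLevel_iff hv, downKey_eq_upKey ht] at hl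
        have := (lt_upLevel_iff hv t ⟨_, hl'⟩).not.mp (by rw [e]; exact lt_irrefl _)
        exact this hl.le
      · rw [← not_lt, lt_downLevel_iff hv, downKey_eq_upKey ht, not_lt] at h1
        rw [lt_upLevel_iff hv] at h2
        rw [← not_touches_iff]
        exact fun hx => h _ (LinkTuple.mem_toConfig.mpr ⟨i, rfl⟩) hx
          (upKey_injective (le_antisymm h2 h1))
  | cross_left e t h =>
    obtain ⟨i, hi⟩ := LinkTuple.mem_toConfig.mp h
    have := downLevel_link hv i
    have h2 := upLevel_link hv i
    have h3 := LevelJoined.cross_left (s := types v.1) (C := C) i (by simp [Link.type, hi])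
    simp only [hi, Link.type] at this h2 h3
    simp only [toLevel, this, h2]
    exact .rel _ _ h3
  | cross_right e t h =>
    obtain ⟨i, hi⟩ := LinkTuple.mem_toConfig.mp h
    have := downLevel_link hv i
    have h2 := upLevel_link hv i
    have h3 := LevelJoined.cross_right (s := types v.1) (C := C) i (by simp [Link.type, hi])
    simp only [hi, Link.type] at this h2 h3
    simp only [toLevel, this, h2]
    exact .rel _ _ h3
  | dbar_bottom e t h =>
    obtain ⟨i, hi⟩ := LinkTuple.mem_toConfig.mp h
    have := downLevel_link hv i
    have h3 := LevelJoined.dbar_bottom (s := types v.1) (C := C) i (by simp [Link.type, hi])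
    simp only [hi, Link.type] at this h3
    simp only [toLevel, this]
    exact .rel _ _ h3
  | dbar_top e t h =>
    obtain ⟨i, hi⟩ := LinkTuple.mem_toConfig.mp h
    have := upLevel_link hv i
    have h3 := LevelJoined.dbar_top (s := types v.1) (C := C) i (by simp [Link.type, hi])
    simp only [hi, Link.type] at this h3
    simp only [toLevel, this]
    exact .rel _ _ h3

variable {t₀ : Time β} (ht₀ : t₀.1 = 0)
include ht₀

theorem upLevel_levelTime (j : Fin (k + 1)) : upLevel v.1 (levelTime v.1 t₀ j) = j := by
  cases j using Fin.cases with
  | zero => exact upLevel_zero hv ht₀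
  | succ i => exact upLevel_link hv i

theorem toLevel_ofLevel (p : Vertex ℓ × Fin (k + 1)) : toLevel v.1 (ofLevel v.1 t₀ p) = p := by
  simp [toLevel, ofLevel, upLevel_levelTime hv ht₀]

include hD

/-- A bottom is reached vertically from the beginning of its level. -/
theorem joined_ofLevel_bottom (x : Vertex ℓ) (t : Time β) :
    Joined v.toConfig D (ofLevel v.1 t₀ (x, downLevel v.1 t)) (x, t, Side.bottom) := by
  set j := downLevel v.1 t with hj
  have hlt : upKey (levelTime v.1 t₀ j) < downKey t := by
    cases hj' : j using Fin.cases with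
    | zero => simpa [levelTime, upKey_eq_zero ht₀] using downKey_pos t
    | succ i =>
      simp only [levelTime, Fin.cons_succ]
      rw [← lt_downLevel_iff hv, ← hj, hj']
      exact Fin.castSucc_lt_succ
  refine .vertical x _ t ?_ ?_
  · intro s hs hb
    rw [between_zero_iff _ _ ((hD _).mp hs).2] at hb
    exact absurd hlt (not_lt.mpr hb)
  · intro l hl _ hb
    obtain ⟨i, rfl⟩ := LinkTuple.mem_toConfig.mp hl
    rw [between_iff _ _ (hv.ne_zero i), if_pos hlt, ← lt_downLevel_iff hv, ← not_le,
      ← lt_upLevel_iff hv, upLevel_levelTime hv ht₀] at hb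
    exact hb.1 hb.2

/-- Each end is joined to the lowest end of its level. -/
theorem eqvGen_ofLevel_toLevel (a : End ℓ β) :
    EqvGen (Joined v.toConfig D) (ofLevel v.1 t₀ (toLevel v.1 a)) a := by
  obtain ⟨x, t, side⟩ := a
  cases side with
  | bottom => exact .rel _ _ (joined_ofLevel_bottom hv hD ht₀ x t)
  | top =>
    simp only [toLevel]
    by_cases h : ∃ j, levelTime v.1 t₀ j = t
    · obtain ⟨j, rfl⟩ := h
      rw [upLevel_levelTime hv ht₀]
      exact .refl _
    · have hne : ∀ i, (v.1 i).1.2 ≠ t := fun i hi => h ⟨i.succ, hi⟩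
      have hz : t.1 ≠ 0 := fun hz => h ⟨0, Subtype.ext (ht₀.trans hz.symm)⟩
      have hlev : upLevel v.1 t = downLevel v.1 t := by
        refine upLevel_eq hv _ _ fun i => ?_
        rw [lt_downLevel_iff hv, downKey_eq_upKey hz]
        exact ⟨fun hle => hle.lt_of_ne (upKey_injective.ne (hne i)), le_of_lt⟩
      rw [hlev]
      refine .trans _ _ _ (.rel _ _ (joined_ofLevel_bottom hv hD ht₀ x t)) (.rel _ _ ?_)
      refine .through x t (fun hm => hz ((hD _).mp hm).2) fun l hl _ => ?_
      obtain ⟨i, rfl⟩ := LinkTuple.mem_toConfig.mp hl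
      exact hne i

/-- Each edge of the level graph is realised by a piece of a loop. -/
theorem eqvGen_joined_of_levelJoined {p q : Vertex ℓ × Fin (k + 1)}
    (h : LevelJoined (types v.1) C p q) :
    EqvGen (Joined v.toConfig D) (ofLevel v.1 t₀ p) (ofLevel v.1 t₀ q) := by
  have hb : ∀ x i, EqvGen (Joined v.toConfig D) (ofLevel v.1 t₀ (x, i.castSucc))
      (x, (v.1 i).1.2, Side.bottom) := fun x i => by
    have := joined_ofLevel_bottom hv hD ht₀ x (v.1 i).1.2
    rw [downLevel_link hv] at this
    exact .rel _ _ this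
  have hmem : ∀ i m, (types v.1 i).2 = m →
      (((types v.1 i).1, (v.1 i).1.2), m) ∈ v.toConfig.links := fun i m hm => by
    rw [LinkTuple.mem_toConfig]
    exact ⟨i, Prod.ext rfl hm⟩
  cases h with
  | straight i z hl hr =>
    refine .trans _ _ _ (hb z i) (.rel _ _ ?_)
    refine .through z _ (fun hm => hv.ne_zero i ((hD _).mp hm).2) fun l hl' ht heq => ?_
    obtain ⟨j, rfl⟩ := LinkTuple.mem_toConfig.mp hl'
    have : j = i := hv.strictMono.injective (congrArg upKey heq)
    subst this
    exact not_touches_iff.mpr ⟨hl, hr⟩ ht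
  | cross_left i h => exact .trans _ _ _ (hb _ i) (.rel _ _ (.cross_left _ _ (hmem i _ h)))
  | cross_right i h => exact .trans _ _ _ (hb _ i) (.rel _ _ (.cross_right _ _ (hmem i _ h)))
  | dbar_bottom i h =>
    exact .trans _ _ _ (hb _ i) (.trans _ _ _ (.rel _ _ (.dbar_bottom _ _ (hmem i _ h)))
      (.symm _ _ (hb _ i)))
  | dbar_top i h => exact .rel _ _ (.dbar_top _ _ (hmem i _ h))
  | close z hz =>
    have := joined_ofLevel_bottom hv hD ht₀ z t₀
    rw [downLevel_zero hv ht₀] at this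
    refine .trans _ _ _ (.rel _ _ this) (.rel _ _ ?_)
    refine .through z t₀ (fun hm => hz ((hD _).mp hm).1) fun l hl _ heq => ?_
    obtain ⟨j, rfl⟩ := LinkTuple.mem_toConfig.mp hl
    exact hv.ne_zero j (by rw [heq, ht₀])

/-- The loops, possibly cut at time `0`, correspond to the components of the level graph. -/
def loopEquiv : Quot (Joined v.toConfig D) ≃ Quot (LevelJoined (types v.1) C) where
  toFun := Quot.lift (fun a => Quot.mk _ (toLevel v.1 a)) fun _ _ h =>
    Quot.eqvGen_sound (eqvGen_levelJoined_of_joined hv hD h)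
  invFun := Quot.lift (fun p => Quot.mk _ (ofLevel v.1 t₀ p)) fun _ _ h =>
    Quot.eqvGen_sound (eqvGen_joined_of_levelJoined hv hD ht₀ h)
  left_inv q := by
    induction q using Quot.ind with
    | mk a => exact Quot.eqvGen_sound (eqvGen_ofLevel_toLevel hv hD ht₀ a)
  right_inv q := by
    induction q using Quot.ind with
    | mk p => exact congrArg (Quot.mk _) (toLevel_ofLevel hv ht₀ p)

theorem eqvGen_joined_iff (a b : End ℓ β) : EqvGen (Joined v.toConfig D) a b ↔
    EqvGen (LevelJoined (types v.1) C) (toLevel v.1 a) (toLevel v.1 b) := by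
  rw [← Quot.eq, ← (loopEquiv hv hD ht₀).injective.eq_iff, ← Quot.eq]
  rfl

end

/-! ### Integration over configurations -/

section

variable {ℓ : ℕ} {β : ℝ}

/-- Lebesgue measure on the time interval. -/
def timeMeasure (β : ℝ) : Measure (Time β) := Measure.comap (Subtype.val : Time β → ℝ) volume

instance : IsFiniteMeasure (timeMeasure β) := ⟨by
  rw [timeMeasure, comap_subtype_coe_apply measurableSet_Ioo, Set.image_univ, Subtype.range_coe]
  exact measure_Ioo_lt_top⟩

instance : MeasurableSingletonClass Mark := ⟨fun _ => trivial⟩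

theorem measureReal_timeMeasure_univ (hβ : 0 < β) : (timeMeasure β).real Set.univ = 2 * β := by
  rw [timeMeasure, Measure.real, comap_subtype_coe_apply measurableSet_Ioo, Set.image_univ,
    Subtype.range_coe, Real.volume_Ioo, ENNReal.toReal_ofReal (by linarith)]
  ring

instance : NullSingletonClass (timeMeasure β) := ⟨fun t => by
  rw [timeMeasure, comap_subtype_coe_apply measurableSet_Ioo]
  simp⟩

instance : IsFiniteMeasure (linkMeasure ℓ β) := by
  have : IsFiniteMeasure (Measure.comap (Subtype.val : Time β → ℝ) volume) :=
    inferInstanceAs (IsFiniteMeasure (timeMeasure β))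
  unfold linkMeasure
  infer_instance

/-- The counting measure on link types. -/
abbrev typeMeasure (ℓ : ℕ) : Measure (LinkType ℓ) :=
  (Measure.count : Measure (Edge ℓ)).prod (Measure.count : Measure Mark)

/-- The separation of a link into its type and its time. -/
def linkEquiv (ℓ : ℕ) (β : ℝ) : Link ℓ β ≃ᵐ LinkType ℓ × Time β :=
  MeasurableEquiv.prodAssoc.trans
    (((MeasurableEquiv.refl _).prodCongr MeasurableEquiv.prodComm).trans
      MeasurableEquiv.prodAssoc.symm)

theorem measurePreserving_linkEquiv :
    MeasurePreserving (linkEquiv ℓ β) (linkMeasure ℓ β) ((typeMeasure ℓ).prod (timeMeasure β)) := by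
  refine MeasurePreserving.trans (measurePreserving_prodAssoc _ (timeMeasure β) _) ?_
  refine MeasurePreserving.trans
    (μb := Measure.count.prod (Measure.count.prod (timeMeasure β))) ?_ ?_
  · exact (MeasurePreserving.id _).prod Measure.measurePreserving_swap
  · exact (measurePreserving_prodAssoc _ _ _).symm

/-- The separation of a tuple of links into its types and its times. -/
def tupleEquiv (ℓ : ℕ) (β : ℝ) (k : ℕ) :
    (Fin k → Link ℓ β) ≃ᵐ (Fin k → LinkType ℓ) × (Fin k → Time β) :=
  (MeasurableEquiv.piCongrRight fun _ => linkEquiv ℓ β).trans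
    (MeasurableEquiv.arrowProdEquivProdArrow _ _ _)

theorem measurePreserving_tupleEquiv (k : ℕ) :
    MeasurePreserving (tupleEquiv ℓ β k) (Measure.pi fun _ => linkMeasure ℓ β)
      ((Measure.pi fun _ => typeMeasure ℓ).prod (Measure.pi fun _ => timeMeasure β)) :=
  (measurePreserving_pi _ _ fun _ => measurePreserving_linkEquiv).trans
    (measurePreserving_arrowProdEquivProdArrow _ _ _ _ _)

/-- The integral over tuples of links, as a sum over types of integrals over times. -/
theorem integral_tuple {k : ℕ} (F : (Fin k → Link ℓ β) → ℝ)
    (hF : Integrable F (Measure.pi fun _ => linkMeasure ℓ β)) :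
    ∫ v, F v ∂(Measure.pi fun _ => linkMeasure ℓ β) =
      ∑ s : Fin k → LinkType ℓ, ∫ t : Fin k → Time β, F (fun i => (((s i).1, t i), (s i).2))
        ∂(Measure.pi fun _ => timeMeasure β) := by
  have h := (measurePreserving_tupleEquiv (ℓ := ℓ) (β := β) k).symm
  have hi := h.integrable_comp_of_integrable hF
  simp only [Function.comp_def] at hi
  rw [← h.integral_comp', integral_prod _ hi, integral_fintype]
  · refine Finset.sum_congr rfl fun s _ => ?_
    have h1 : (Measure.pi fun _ : Fin k => typeMeasure ℓ).real {s} = 1 := by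
      have h2 (a : LinkType ℓ) : typeMeasure ℓ {a} = 1 := by
        rw [← Prod.mk.eta (p := a), ← Set.singleton_prod_singleton, Measure.prod_prod]
        simp
      simp [measureReal_def, Measure.pi_singleton, h2]
    rw [h1, one_smul]
    rfl
  · exact Integrable.of_finite

/-! #### Sorting the links -/

theorem measurable_upKey : Measurable (upKey (β := β)) := by
  unfold upKey
  refine Measurable.ite ?_ measurable_subtype_coe (measurable_subtype_coe.add_const _)
  exact measurableSet_le measurable_const measurable_subtype_coe

theorem measurableSet_inOrder (k : ℕ) : MeasurableSet {v : Fin k → Link ℓ β | InOrder v} := by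
  have : {v : Fin k → Link ℓ β | InOrder v} =
      {v | ∀ i j, i < j → upKey (v i).1.2 < upKey (v j).1.2} ∩ {v | ∀ i, (v i).1.2.1 ≠ 0} := by
    ext v
    exact ⟨fun h => ⟨fun i j hij => h.1 hij, h.2⟩, fun h => ⟨fun i j hij => h.1 i j hij, h.2⟩⟩
  rw [this]
  have ht : ∀ i : Fin k, Measurable fun v : Fin k → Link ℓ β => (v i).1.2 :=
    fun i => (measurable_pi_apply i).fst.snd
  refine MeasurableSet.inter ?_ ?_
  · simp only [Set.ofPred_forall]
    refine .iInter fun i => .iInter fun j => .iInter fun _ => ?_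
    exact measurableSet_lt (measurable_upKey.comp (ht i)) (measurable_upKey.comp (ht j))
  · simp only [Set.ofPred_forall]
    refine .iInter fun i => ?_
    exact (measurableSet_eq_fun (measurable_subtype_coe.comp (ht i)) measurable_const).compl

/-- The times of a tuple are generic: pairwise different and different from time `0`. -/
def Generic {k : ℕ} (t : Fin k → Time β) : Prop :=
  Function.Injective t ∧ ∀ i, (t i).1 ≠ 0

open Classical in
/-- The value of a function of ordered link types at the tuple `v`, put into its order; it is zero
if `v` has no order. -/
def sortedValue {k : ℕ} (G : (Fin k → LinkType ℓ) → ℝ) (v : Fin k → Link ℓ β) : ℝ :=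
  ∑ π : Equiv.Perm (Fin k), if InOrder (v ∘ π) then G (types (v ∘ π)) else 0

theorem generic_of_inOrder {k : ℕ} {v : Fin k → Link ℓ β} {π : Equiv.Perm (Fin k)}
    (h : InOrder (v ∘ π)) : Generic fun i => (v i).1.2 := by
  constructor
  · intro i j hij
    have := h.strictMono.injective (a₁ := π.symm i) (a₂ := π.symm j) (by simp_all)
    exact π.symm.injective this
  · intro i
    simpa using h.ne_zero (π.symm i)

/-- Links at generic times have a unique order. -/
theorem exists_unique_inOrder {k : ℕ} {v : Fin k → Link ℓ β} (h : Generic fun i => (v i).1.2) :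
    ∃ π : Equiv.Perm (Fin k), ∀ π' : Equiv.Perm (Fin k), InOrder (v ∘ π') ↔ π' = π := by
  set key : Fin k → ℝ := fun i => upKey (v i).1.2 with hkey
  have hinj : Function.Injective key := upKey_injective.comp h.1
  refine ⟨Tuple.sort key, fun π' => ⟨fun h' => ?_, ?_⟩⟩
  · have h1 : Monotone (key ∘ π') := h'.strictMono.monotone
    have := Tuple.unique_monotone h1 (Tuple.monotone_sort key)
    exact Equiv.ext fun i => hinj (congrFun this i)
  · rintro rfl
    exact ⟨(Tuple.monotone_sort key).strictMono_of_injective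
      (hinj.comp (Equiv.injective _)), fun i => h.2 _⟩

theorem measurable_type : Measurable (Link.type : Link ℓ β → LinkType ℓ) :=
  measurable_fst.fst.prodMk measurable_snd

theorem measurable_sortedValue {k : ℕ} (G : (Fin k → LinkType ℓ) → ℝ) :
    Measurable (sortedValue (β := β) G) := by
  unfold sortedValue
  refine Finset.measurable_fun_sum _ fun π _ => ?_
  have hπ : Measurable fun v : Fin k → Link ℓ β => v ∘ π :=
    measurable_pi_lambda _ fun i => measurable_pi_apply _
  refine Measurable.ite (hπ (measurableSet_inOrder k)) ?_ measurable_const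
  refine (measurable_of_finite G).comp (measurable_pi_lambda _ fun i => ?_)
  exact measurable_type.comp (measurable_pi_apply _)

theorem abs_sortedValue_le {k : ℕ} (G : (Fin k → LinkType ℓ) → ℝ) (v : Fin k → Link ℓ β) :
    |sortedValue G v| ≤ ∑ _π : Equiv.Perm (Fin k), ∑ s, |G s| := by
  refine (Finset.abs_sum_le_sum_abs _ _).trans (Finset.sum_le_sum fun π _ => ?_)
  split_ifs
  · exact Finset.single_le_sum (f := fun s => |G s|) (fun s _ => abs_nonneg _) (Finset.mem_univ _)
  · simpa using Finset.sum_nonneg fun s _ => abs_nonneg (G s)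

theorem integrable_sortedValue {k : ℕ} (G : (Fin k → LinkType ℓ) → ℝ) :
    Integrable (sortedValue (β := β) G) (Measure.pi fun _ => linkMeasure ℓ β) :=
  Integrable.of_bound (measurable_sortedValue G).aestronglyMeasurable _
    (.of_forall (abs_sortedValue_le G))

/-- Almost all times are generic. -/
theorem ae_generic (k : ℕ) :
    ∀ᵐ t ∂(Measure.pi fun _ : Fin k => timeMeasure β), Generic t := by
  have h0 : ∀ᵐ t ∂(Measure.pi fun _ : Fin k => timeMeasure β), ∀ i, (t i).1 ≠ 0 := by
    rw [ae_all_iff]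
    intro i
    refine (Measure.quasiMeasurePreserving_eval (fun _ : Fin k => timeMeasure β) i).ae
      (p := fun t : Time β => t.1 ≠ 0) ?_
    rw [ae_iff]
    refine Set.Subsingleton.measure_zero (fun a ha b hb => Subtype.ext ?_) _
    simp only [not_not, Set.mem_ofPred_eq] at ha hb
    rw [ha, hb]
  have h1 : ∀ᵐ t ∂(Measure.pi fun _ : Fin k => timeMeasure β), ∀ i j, i ≠ j → t i ≠ t j := by
    rw [ae_all_iff]
    intro i
    rw [ae_all_iff]
    intro j
    rw [ae_iff]
    by_cases hij : i = j
    · simp [hij]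
    cases k with
    | zero => exact i.elim0
    | succ k =>
      obtain ⟨j', rfl⟩ := Fin.exists_succAbove_eq (Ne.symm hij)
      have hp := measurePreserving_piFinSuccAbove (fun _ : Fin (k + 1) => timeMeasure β) i
      have hm : MeasurableSet {p : Time β × (Fin k → Time β) | p.1 = p.2 j'} :=
        measurableSet_eq_fun measurable_fst ((measurable_pi_apply j').comp measurable_snd)
      have : {t : Fin (k + 1) → Time β | ¬ (i ≠ i.succAbove j' → t i ≠ t (i.succAbove j'))} =
          (MeasurableEquiv.piFinSuccAbove (fun _ => Time β) i) ⁻¹' {p | p.1 = p.2 j'} := by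
        ext t
        simp only [ne_eq, Fin.ne_succAbove, not_false_eq_true, forall_const, not_not]
        exact Iff.rfl
      rw [this, hp.measure_preimage hm.nullMeasurableSet, Measure.prod_apply_symm hm]
      refine (lintegral_congr fun y => ?_).trans lintegral_zero
      exact measure_singleton (y j')
  filter_upwards [h0, h1] with t h0 h1
  exact ⟨fun i j hij => by_contra fun h => h1 i j h hij, h0⟩

/-- For fixed times, summing over the types of all links in the order of the times is the same as
summing over all sequences of types, whatever that order is. Hence each order contributes the same,
and the volume of the set of ordered times is not needed. -/
theorem integral_sortedValue (hβ : 0 < β) {k : ℕ} (G : (Fin k → LinkType ℓ) → ℝ) :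
    ∫ v, sortedValue (β := β) G v ∂(Measure.pi fun _ => linkMeasure ℓ β) =
      (2 * β) ^ k * ∑ s, G s := by
  classical
  rw [integral_tuple _ (integrable_sortedValue G), ← integral_finsetSum]
  · have hE : (fun t : Fin k → Time β => ∑ s : Fin k → LinkType ℓ,
        sortedValue G fun i => (((s i).1, t i), (s i).2))
        =ᵐ[Measure.pi fun _ => timeMeasure β] fun _ => ∑ s, G s := by
      filter_upwards [ae_generic k] with t ht
      rcases isEmpty_or_nonempty (Fin k → LinkType ℓ) with hs | ⟨⟨s₀⟩⟩
      · simp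
      · obtain ⟨π, hπ⟩ := exists_unique_inOrder
          (v := fun i => (((s₀ i).1, t i), (s₀ i).2)) (by exact ht)
        have hπ' : ∀ (s : Fin k → LinkType ℓ) (π' : Equiv.Perm (Fin k)),
            InOrder ((fun i => (((s i).1, t i), (s i).2) : Fin k → Link ℓ β) ∘ π') ↔ π' = π :=
          fun s π' => by
            rw [← hπ]
            exact ⟨fun h => ⟨h.1, h.2⟩, fun h => ⟨h.1, h.2⟩⟩
        simp only [sortedValue, hπ', Finset.sum_ite_eq', Finset.mem_univ, if_true]
        exact Equiv.sum_comp (Equiv.arrowCongr π.symm (Equiv.refl (LinkType ℓ))) G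
    rw [integral_congr_ae hE]
    simp [Measure.real, Measure.pi_univ]
    left
    exact congrArg (· ^ k) (measureReal_timeMeasure_univ hβ)
  · intro s _
    have hm : Measurable fun t : Fin k → Time β => (fun i => (((s i).1, t i), (s i).2) :
        Fin k → Link ℓ β) := by
      fun_prop
    exact Integrable.of_bound ((measurable_sortedValue G).comp hm).aestronglyMeasurable _
      (.of_forall fun v => abs_sortedValue_le G _)

end

section

variable {ℓ : ℕ} {β : ℝ}

/-- The links of a configuration sit at pairwise different times, none of which is `0`. -/
def Config.IsGeneric (ω : Config ℓ β) : Prop :=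
  Set.InjOn (fun l : Link ℓ β => l.1.2) ω.links ∧ ∀ l ∈ ω.links, l.1.2.1 ≠ 0

theorem LinkTuple.isGeneric_toConfig_iff {k : ℕ} {v : LinkTuple ℓ β k} :
    v.toConfig.IsGeneric ↔ Generic fun i => (v.1 i).1.2 := by
  constructor
  · intro h
    refine ⟨fun i j hij => ?_, fun i => h.2 _ (LinkTuple.mem_toConfig.mpr ⟨i, rfl⟩)⟩
    have := h.1 (LinkTuple.mem_toConfig.mpr ⟨i, rfl⟩) (LinkTuple.mem_toConfig.mpr ⟨j, rfl⟩) hij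
    exact v.2 (congrArg Prod.fst this)
  · intro h
    constructor
    · intro a ha b hb hab
      obtain ⟨i, rfl⟩ := LinkTuple.mem_toConfig.mp ha
      obtain ⟨j, rfl⟩ := LinkTuple.mem_toConfig.mp hb
      rw [h.1 hab]
    · intro l hl
      obtain ⟨i, rfl⟩ := LinkTuple.mem_toConfig.mp hl
      exact h.2 i

/-- The tuple `v` with its entries permuted by `π`. -/
def LinkTuple.reorder {k : ℕ} (v : LinkTuple ℓ β k) (π : Equiv.Perm (Fin k)) : LinkTuple ℓ β k :=
  ⟨v.1 ∘ π, v.2.comp π.injective⟩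

theorem LinkTuple.toConfig_reorder {k : ℕ} (v : LinkTuple ℓ β k) (π : Equiv.Perm (Fin k)) :
    (v.reorder π).toConfig = v.toConfig := by
  apply Config.ext
  ext l
  rw [LinkTuple.mem_toConfig, LinkTuple.mem_toConfig]
  exact (π.surjective.exists (p := fun i => v.1 i = l)).symm

/-- Functions of configurations are measurable when they are so as functions of tuples, as `Config`
carries the final σ-algebra. -/
theorem measurable_config_iff {f : Config ℓ β → ℝ} :
    Measurable f ↔ ∀ k, Measurable fun v : LinkTuple ℓ β k => f v.toConfig := by
  refine ⟨fun h k => h.comp LinkTuple.measurable_toConfig, fun h s hs => ?_⟩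
  exact MeasurableSpace.measurableSet_iInf.mpr fun k => h k hs

open Classical in
/-- `f`, set to zero at the configurations that are not generic. -/
def restrictGeneric (f : Config ℓ β → ℝ) (ω : Config ℓ β) : ℝ :=
  if ω.IsGeneric then f ω else 0

/-- The function `f` takes the value `G s` at the configurations of links of types `s`, met in this
order when moving upwards from time `0`. -/
def HasOrderedValue (f : Config ℓ β → ℝ) (G : ∀ k, (Fin k → LinkType ℓ) → ℝ) : Prop :=
  ∀ k (v : LinkTuple ℓ β k), InOrder v.1 → f v.toConfig = G k (types v.1)

/-- A tuple that is not generic has no order, so that both sides vanish there. -/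
theorem HasOrderedValue.restrictGeneric_toConfig {f : Config ℓ β → ℝ}
    {G : ∀ k, (Fin k → LinkType ℓ) → ℝ} (hG : HasOrderedValue f G) {k : ℕ} (v : LinkTuple ℓ β k) :
    restrictGeneric f v.toConfig = sortedValue (G k) v.1 := by
  classical
  by_cases h : v.toConfig.IsGeneric
  · rw [restrictGeneric, if_pos h]
    obtain ⟨π, hπ⟩ := exists_unique_inOrder (LinkTuple.isGeneric_toConfig_iff.mp h)
    have := hG k (v.reorder π) ((hπ π).mpr rfl)
    rw [LinkTuple.toConfig_reorder] at this
    simp only [sortedValue, hπ, Finset.sum_ite_eq', Finset.mem_univ, if_true, this]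
    rfl
  · rw [restrictGeneric, if_neg h, sortedValue, Finset.sum_eq_zero]
    intro π _
    rw [if_neg]
    exact fun h' => h (LinkTuple.isGeneric_toConfig_iff.mpr (generic_of_inOrder h'))

theorem HasOrderedValue.measurable_restrictGeneric {f : Config ℓ β → ℝ}
    {G : ∀ k, (Fin k → LinkType ℓ) → ℝ} (hG : HasOrderedValue f G) :
    Measurable (restrictGeneric f) := by
  refine measurable_config_iff.mpr fun k => ?_
  simp only [hG.restrictGeneric_toConfig]
  exact (measurable_sortedValue (G k)).comp measurable_subtype_coe

/-- The set of tuples that `LinkTuple` selects is measurable. -/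
theorem measurableSet_linkTuple (k : ℕ) :
    MeasurableSet {v : Fin k → Link ℓ β | Function.Injective fun i => (v i).1} := by
  simp only [Function.Injective, Set.ofPred_forall]
  refine .iInter fun i => .iInter fun j => ?_
  by_cases hij : i = j
  · simp [hij]
  · simp only [hij, imp_false]
    exact (measurableSet_eq_fun (measurable_pi_apply i).fst (measurable_pi_apply j).fst).compl

theorem measurableSet_isGeneric : MeasurableSet {ω : Config ℓ β | ω.IsGeneric} := by
  have h : HasOrderedValue (fun _ : Config ℓ β => 1) (fun _ _ => 1) := fun _ _ _ => rfl
  have := h.measurable_restrictGeneric (measurableSet_singleton (1 : ℝ))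
  convert this using 1
  ext ω
  by_cases hω : ω.IsGeneric <;> simp [restrictGeneric, hω]

theorem ae_generic_links (k : ℕ) :
    ∀ᵐ v ∂(Measure.pi fun _ : Fin k => linkMeasure ℓ β), Generic fun i => (v i).1.2 := by
  have h := (ae_generic (β := β) k)
  have h2 := (Measure.quasiMeasurePreserving_snd
    (μ := Measure.pi fun _ : Fin k => typeMeasure ℓ)
    (ν := Measure.pi fun _ : Fin k => timeMeasure β)).ae h
  exact (measurePreserving_tupleEquiv (ℓ := ℓ) (β := β) k).quasiMeasurePreserving.ae h2

/-- The part of `configMeasure` on configurations with `k` links, without the factor `1 / k!`. -/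
def configMeasureCard (ℓ : ℕ) (β : ℝ) (k : ℕ) : Measure (Config ℓ β) :=
  Measure.map LinkTuple.toConfig
      (Measure.comap (Subtype.val : LinkTuple ℓ β k → (Fin k → Link ℓ β))
        (Measure.pi fun _ => linkMeasure ℓ β))

theorem ae_isGeneric_configMeasureCard (k : ℕ) : ∀ᵐ ω ∂configMeasureCard ℓ β k, ω.IsGeneric := by
  rw [configMeasureCard,
    ae_map_iff LinkTuple.measurable_toConfig.aemeasurable measurableSet_isGeneric]
  simp only [LinkTuple.isGeneric_toConfig_iff]
  have he := MeasurableEmbedding.subtype_coe (measurableSet_linkTuple (ℓ := ℓ) (β := β) k)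
  have h := ae_restrict_of_ae (s := {v | Function.Injective fun i => (v i).1})
    (ae_generic_links (ℓ := ℓ) (β := β) k)
  rw [← map_comap_subtype_coe (measurableSet_linkTuple k), he.ae_map_iff] at h
  exact h

theorem ae_isGeneric : ∀ᵐ ω ∂configMeasure ℓ β, ω.IsGeneric := by
  rw [configMeasure, Measure.ae_sum_iff]
  exact fun k => Measure.ae_smul_measure (ae_isGeneric_configMeasureCard k) _

theorem restrictGeneric_ae_eq {f : Config ℓ β → ℝ} {μ : Measure (Config ℓ β)}
    (h : ∀ᵐ ω ∂μ, ω.IsGeneric) : restrictGeneric f =ᵐ[μ] f := by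
  filter_upwards [h] with ω hω
  rw [restrictGeneric, if_pos hω]

theorem HasOrderedValue.aestronglyMeasurable {f : Config ℓ β → ℝ}
    {G : ∀ k, (Fin k → LinkType ℓ) → ℝ} (hG : HasOrderedValue f G) :
    AEStronglyMeasurable f (configMeasure ℓ β) :=
  ⟨_, hG.measurable_restrictGeneric.stronglyMeasurable, (restrictGeneric_ae_eq ae_isGeneric).symm⟩

theorem sortedValue_eq_zero {k : ℕ} (G : (Fin k → LinkType ℓ) → ℝ) (v : Fin k → Link ℓ β)
    (hv : ¬ Function.Injective fun i => (v i).1) : sortedValue G v = 0 := by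
  classical
  rw [sortedValue, Finset.sum_eq_zero]
  intro π _
  rw [if_neg]
  intro h
  exact hv fun i j hij => (generic_of_inOrder h).1 (congrArg Prod.snd hij)

theorem HasOrderedValue.integrable_configMeasureCard {f : Config ℓ β → ℝ}
    {G : ∀ k, (Fin k → LinkType ℓ) → ℝ} (hG : HasOrderedValue f G) (k : ℕ) :
    Integrable f (configMeasureCard ℓ β k) := by
  refine Integrable.congr ?_ (restrictGeneric_ae_eq (ae_isGeneric_configMeasureCard k))
  rw [configMeasureCard, integrable_map_measure hG.measurable_restrictGeneric.aestronglyMeasurable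
    LinkTuple.measurable_toConfig.aemeasurable]
  simp only [Function.comp_def, hG.restrictGeneric_toConfig]
  have he := MeasurableEmbedding.subtype_coe (measurableSet_linkTuple (ℓ := ℓ) (β := β) k)
  have h := (integrable_sortedValue (β := β) (G k)).integrableOn
    (s := {v | Function.Injective fun i => (v i).1})
  rw [IntegrableOn, ← map_comap_subtype_coe (measurableSet_linkTuple k),
    he.integrable_map_iff] at h
  exact h

theorem HasOrderedValue.integral_configMeasureCard (hβ : 0 < β) {f : Config ℓ β → ℝ}
    {G : ∀ k, (Fin k → LinkType ℓ) → ℝ} (hG : HasOrderedValue f G) (k : ℕ) :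
    ∫ ω, f ω ∂configMeasureCard ℓ β k = (2 * β) ^ k * ∑ s, G k s := by
  rw [← integral_congr_ae (restrictGeneric_ae_eq (ae_isGeneric_configMeasureCard k)),
    configMeasureCard,
    integral_map LinkTuple.measurable_toConfig.aemeasurable
      hG.measurable_restrictGeneric.aestronglyMeasurable]
  simp only [hG.restrictGeneric_toConfig]
  refine (integral_subtype_comap (measurableSet_linkTuple k) (sortedValue (G k))).trans ?_
  rw [setIntegral_eq_integral_of_forall_compl_eq_zero
    (s := {v : Fin k → Link ℓ β | Function.Injective fun i => (v i).1})
    (fun v hv => sortedValue_eq_zero _ v hv), integral_sortedValue hβ]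

/-- The integral of a function that depends only on the types of the links, in their order. The
factor `1 / k!` of the configuration measure becomes that of the exponential series. -/
theorem HasOrderedValue.hasSum_integral (hβ : 0 < β) {f : Config ℓ β → ℝ}
    {G : ∀ k, (Fin k → LinkType ℓ) → ℝ} (hG : HasOrderedValue f G) (M : ℝ) (K : ℝ)
    (hK : ∀ k s, |G k s| ≤ M * K ^ k) :
    Integrable f (configMeasure ℓ β) ∧
      HasSum (fun k : ℕ => (2 * β) ^ k / k ! * ∑ s, G k s) (∫ ω, f ω ∂configMeasure ℓ β) := by
  have hfac (k : ℕ) : ((k ! : ℝ≥0∞)⁻¹).toReal = (k ! : ℝ)⁻¹ := by simp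
  have hint (k : ℕ) : Integrable f ((k ! : ℝ≥0∞)⁻¹ • configMeasureCard ℓ β k) :=
    (hG.integrable_configMeasureCard k).smul_measure
      (ENNReal.inv_ne_top.mpr (Nat.cast_ne_zero.mpr (Nat.factorial_ne_zero k)))
  -- The absolute value also depends on the ordered types only, which gives absolute convergence.
  have habs : HasOrderedValue (fun ω => ‖f ω‖) (fun k s => |G k s|) := fun k v hv => by
    simp only [Real.norm_eq_abs, hG k v hv]
  have hi : Integrable f (configMeasure ℓ β) := by
    refine integrable_sum_measure hint ?_
    simp only [integral_smul_measure, hfac]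
    refine Summable.of_nonneg_of_le (fun k => ?_) (fun k => ?_)
      ((Real.summable_pow_div_factorial (2 * β * (Fintype.card (LinkType ℓ) * K))).mul_left M)
    · exact smul_nonneg (by positivity) (integral_nonneg fun _ => norm_nonneg _)
    · have h1 := habs.integral_configMeasureCard hβ k
      rw [configMeasureCard] at h1
      rw [h1, smul_eq_mul]
      have h2 : ∑ s : Fin k → LinkType ℓ, |G k s| ≤ Fintype.card (LinkType ℓ) ^ k * (M * K ^ k) :=
        (Finset.sum_le_card_nsmul _ _ _ fun s _ => hK k s).trans_eq (by simp)
      calc (k ! : ℝ)⁻¹ * ((2 * β) ^ k * ∑ s : Fin k → LinkType ℓ, |G k s|)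
          ≤ (k ! : ℝ)⁻¹ * ((2 * β) ^ k * (Fintype.card (LinkType ℓ) ^ k * (M * K ^ k))) := by
            gcongr
        _ = _ := by rw [mul_pow (2 * β), mul_pow (Fintype.card (LinkType ℓ) : ℝ)]; ring
  refine ⟨hi, ?_⟩
  have := hasSum_integral_measure hi
  refine (congrArg (fun f => HasSum f _) (funext fun k => ?_)).mpr this
  rw [integral_smul_measure, hfac, ← configMeasureCard, hG.integral_configMeasureCard hβ,
    smul_eq_mul]
  ring

end

/-! ### The expansion of the trace into paths of spin configurations -/

/-- The entries of a matrix power, as sums over paths. -/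
theorem sum_mul_pow_apply {S : Type*} [Fintype S] [DecidableEq S] (A : Matrix S S ℂ) (k : ℕ)
    (F : S → S → ℂ) : ∑ σ, ∑ τ, F σ τ * (A ^ k) σ τ =
      ∑ p : Fin (k + 1) → S, F (p 0) (p (Fin.last k)) *
        ∏ i : Fin k, A (p i.castSucc) (p i.succ) := by
  induction k generalizing F with
  | zero =>
    rw [← (Equiv.funUnique (Fin 1) S).symm.sum_comp]
    simp [Matrix.one_apply, Equiv.funUnique]
  | succ k ih =>
    rw [← (Fin.consEquiv fun _ => S).sum_comp, Fintype.sum_prod_type]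
    refine Finset.sum_congr rfl fun σ _ => ?_
    have := ih fun ρ τ => F σ τ * A σ ρ
    simp only [Fin.prod_univ_succ, Fin.consEquiv_apply, Fin.cons_zero, Fin.castSucc_zero,
      ← Fin.succ_last, Fin.cons_succ, Fin.castSucc_succ]
    simp only [pow_succ', Matrix.mul_apply, Finset.mul_sum]
    rw [Finset.sum_comm]
    simp only [← mul_assoc]
    exact this

/-- The expansion of the power of a linear combination of the matrices `B j` into words `s` and
paths `p`. The factors are scalars, so that no noncommutative multinomial formula is needed. -/
theorem trace_mul_pow_sum {S J : Type*} [Fintype S] [DecidableEq S] [Fintype J] [DecidableEq J]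
    (W : Matrix S S ℂ) (c : J → ℂ) (B : J → Matrix S S ℂ) (k : ℕ) :
    Matrix.trace (W * (∑ j, c j • B j) ^ k) =
      ∑ s : Fin k → J, (∏ i, c (s i)) *
        ∑ p : Fin (k + 1) → S, W (p (Fin.last k)) (p 0) *
          ∏ i, B (s i) (p i.castSucc) (p i.succ) := by
  have h := sum_mul_pow_apply (∑ j, c j • B j) k fun σ τ => W τ σ
  have h0 : Matrix.trace (W * (∑ j, c j • B j) ^ k) =
      ∑ σ, ∑ τ, W τ σ * ((∑ j, c j • B j) ^ k) σ τ := by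
    simp only [Matrix.trace, Matrix.diag, Matrix.mul_apply]
    rw [Finset.sum_comm]
  rw [h0, h]
  simp only [Matrix.sum_apply, Matrix.smul_apply, smul_eq_mul, Finset.prod_univ_sum,
    Fintype.piFinset_univ, Finset.prod_mul_distrib, Finset.mul_sum]
  rw [Finset.sum_comm]
  exact Finset.sum_congr rfl fun s _ => Finset.sum_congr rfl fun p _ => by ring

/-- The trace of an observable against `exp (c A)`, as a power series in `c`. -/
theorem hasSum_trace_mul_exp {S : Type*} [Fintype S] [DecidableEq S] (W A : Matrix S S ℂ) (c : ℂ) :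
    HasSum (fun k : ℕ => c ^ k / k ! * Matrix.trace (W * A ^ k))
      (Matrix.trace (W * NormedSpace.exp (c • A))) := by
  open scoped Matrix.Norms.Operator in
  have h : HasSum (fun k : ℕ => ((k ! : ℂ)⁻¹) • (c • A) ^ k) (NormedSpace.exp (c • A)) :=
    NormedSpace.exp_series_hasSum_exp' (𝕂 := ℂ) (c • A)
  let L : Matrix S S ℂ →ₗ[ℂ] ℂ := (Matrix.traceLinearMap S ℂ ℂ) ∘ₗ LinearMap.mulLeft ℂ W
  have hL : Continuous L := LinearMap.continuous_of_finiteDimensional L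
  have := h.map L hL
  refine (congrArg (fun f => HasSum f _) (funext fun k => ?_)).mpr this
  simp only [L, Function.comp_apply, LinearMap.comp_apply, LinearMap.mulLeft_apply,
    Matrix.traceLinearMap_apply, smul_pow, Matrix.mul_smul, Matrix.trace_smul, smul_eq_mul]
  ring

/-! ### Link operators -/

section

variable {n ℓ : ℕ}

theorem Edge.left_ne_right (e : Edge ℓ) : e.left ≠ e.right := by
  intro h
  have := congrArg Subtype.val h
  simp [Edge.left, Edge.right] at this

/-- The spin configurations `σ` and `τ`, just below and just above a link of type `s`, match. -/
def Matches (s : LinkType ℓ) (σ τ : Vertex ℓ → Fin n) : Prop :=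
  (∀ z, z ≠ s.1.left → z ≠ s.1.right → σ z = τ z) ∧
    (s.2 = Mark.cross → σ s.1.left = τ s.1.right ∧ σ s.1.right = τ s.1.left) ∧
    (s.2 = Mark.dbar → σ s.1.left = σ s.1.right ∧ τ s.1.left = τ s.1.right)

open Classical in
/-- The operator of a link: `T` for a cross and `n Q` for a double-bar. -/
def linkOperator (n : ℕ) (s : LinkType ℓ) : Operator n ℓ :=
  Matrix.of fun σ τ => if Matches s σ τ then 1 else 0

/-- The coefficient of the operator of a link in `-H_ℓ`. -/
def linkCoeff (n : ℕ) (u : ℝ) : Mark → ℝ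
  | Mark.cross => u
  | Mark.dbar => (n : ℝ)⁻¹

theorem projQ_apply (p q : Fin n × Fin n) :
    projQ n p q = if p.1 = p.2 ∧ q.1 = q.2 then ((n : ℂ))⁻¹ else 0 := by
  simp only [projQ, Matrix.vecMulVec_apply, psi, Pi.star_apply]
  by_cases h1 : p.1 = p.2 <;> by_cases h2 : q.1 = q.2 <;> simp [h1, h2]
  rw [← mul_inv, ← Complex.ofReal_mul, Real.mul_self_sqrt (Nat.cast_nonneg n)]
  simp

/-- `-H_ℓ` is a combination of the link operators. -/
theorem neg_hamiltonian (u : ℝ) : -hamiltonian n ℓ u =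
    ∑ s : LinkType ℓ, ((linkCoeff n u s.2 : ℝ) : ℂ) • linkOperator n s := by
  classical
  rw [hamiltonian, Fintype.sum_prod_type, ← Finset.sum_neg_distrib]
  refine Finset.sum_congr rfl fun e _ => ?_
  have hu : (Finset.univ : Finset Mark) = {Mark.cross, Mark.dbar} := rfl
  rw [hu, Finset.sum_pair (by simp)]
  ext σ τ
  simp only [atPair, interaction, Matrix.neg_apply, Matrix.of_apply, Matrix.add_apply,
    Matrix.smul_apply, linkOperator, linkCoeff, Matrix.sub_apply, transposition, projQ_apply,
    Matches, smul_eq_mul]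
  by_cases h : ∀ z, z ≠ e.left → z ≠ e.right → σ z = τ z
  · have h1 : ((σ e.left, σ e.right) = (τ e.left, τ e.right).swap) ↔
      σ e.left = τ e.right ∧ σ e.right = τ e.left := by simp
    have h2 : (∀ z, z ≠ e.left → z ≠ e.right → σ z = τ z) ↔ True := iff_true_intro h
    simp only [h1, h2]
    simp only [reduceCtorEq, if_true, true_and, forall_const, false_imp_iff, and_true]
    split_ifs <;> simp [add_comm]
  · have h2 : (∀ z, z ≠ e.left → z ≠ e.right → σ z = τ z) ↔ False := iff_false_intro h
    simp only [h2]
    simp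

end

/-! ### Colourings of the level graph -/

section

variable {n ℓ k : ℕ} {s : Fin k → LinkType ℓ} {C : Set (Vertex ℓ)}

/-- The pieces of loops: the components of the level graph. -/
abbrev Piece (s : Fin k → LinkType ℓ) (C : Set (Vertex ℓ)) : Type := Quot (LevelJoined s C)

instance : Fintype (Piece s C) := Fintype.ofFinite _

instance : DecidableEq (Piece s C) := Classical.decEq _

/-- The piece of a loop that occupies the site `z` at level `j`. -/
abbrev piece (s : Fin k → LinkType ℓ) (C : Set (Vertex ℓ)) (z : Vertex ℓ) (j : Fin (k + 1)) :
    Piece s C := Quot.mk _ (z, j)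

/-- A path of spin configurations matches all links, and closes up off `C`, exactly when it is
constant along the pieces of loops. -/
theorem matches_and_close_iff (p : Fin (k + 1) → Vertex ℓ → Fin n) :
    ((∀ i, Matches (s i) (p i.castSucc) (p i.succ)) ∧ ∀ z, z ∉ C → p (Fin.last k) z = p 0 z) ↔
      ∀ a b, LevelJoined s C a b → p a.2 a.1 = p b.2 b.1 := by
  constructor
  · rintro ⟨h, hc⟩ a b hab
    cases hab with
    | straight i z hl hr => exact (h i).1 z hl hr
    | cross_left i hm => exact ((h i).2.1 hm).1
    | cross_right i hm => exact ((h i).2.1 hm).2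
    | dbar_bottom i hm => exact ((h i).2.2 hm).1
    | dbar_top i hm => exact ((h i).2.2 hm).2
    | close z hz => exact hc z hz
  · intro h
    exact ⟨fun i => ⟨fun z hl hr => h _ _ (.straight i z hl hr),
      fun hm => ⟨h _ _ (.cross_left i hm), h _ _ (.cross_right i hm)⟩,
      fun hm => ⟨h _ _ (.dbar_bottom i hm), h _ _ (.dbar_top i hm)⟩⟩,
      fun z hz => h _ _ (.close z hz)⟩

/-- Paths of spin configurations that are constant along the pieces of loops are colourings of the
pieces. -/
def colouringEquiv (n : ℕ) (s : Fin k → LinkType ℓ) (C : Set (Vertex ℓ)) :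
    {p : Fin (k + 1) → Vertex ℓ → Fin n //
      ∀ a b, LevelJoined s C a b → p a.2 a.1 = p b.2 b.1} ≃ (Piece s C → Fin n) where
  toFun p := Quot.lift (fun a => p.1 a.2 a.1) p.2
  invFun g := ⟨fun j z => g (piece s C z j), fun _ _ h => congrArg g (Quot.sound h)⟩
  left_inv _ := rfl
  right_inv g := by
    funext q
    induction q using Quot.ind with
    | mk a => rfl

open Classical in
/-- The sum over paths that computes the trace of `W` against a product of link operators is a sum
over colourings, when `W` acts as the identity off `C`. -/
theorem sum_path_eq_sum_colouring (W : Operator n ℓ) (w : (Vertex ℓ → Fin n) →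
    (Vertex ℓ → Fin n) → ℂ)
    (hW : ∀ σ τ, W σ τ = if ∀ z, z ∉ C → σ z = τ z then w σ τ else 0) :
    ∑ p : Fin (k + 1) → Vertex ℓ → Fin n, W (p (Fin.last k)) (p 0) *
        ∏ i, linkOperator n (s i) (p i.castSucc) (p i.succ) =
      ∑ g : Piece s C → Fin n, w (fun z => g (piece s C z (Fin.last k)))
        (fun z => g (piece s C z 0)) := by
  have hp (p : Fin (k + 1) → Vertex ℓ → Fin n) : W (p (Fin.last k)) (p 0) *
      ∏ i, linkOperator n (s i) (p i.castSucc) (p i.succ) =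
      if ∀ a b, LevelJoined s C a b → p a.2 a.1 = p b.2 b.1 then w (p (Fin.last k)) (p 0)
        else 0 := by
    rw [hW]
    simp only [linkOperator, Matrix.of_apply, Fintype.prod_boole, ← matches_and_close_iff]
    by_cases h1 : ∀ z, z ∉ C → p (Fin.last k) z = p 0 z
    · by_cases h2 : ∀ i, Matches (s i) (p i.castSucc) (p i.succ)
      · rw [if_pos h1, if_pos h2, if_pos ⟨h2, h1⟩, mul_one]
      · rw [if_neg h2, mul_zero, if_neg fun h => h2 (And.left h)]
    · rw [if_neg h1, zero_mul, if_neg fun h => h1 (And.right h)]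
  rw [Finset.sum_congr rfl fun p _ => hp p, ← Finset.sum_filter,
    Finset.sum_subtype (p := fun p => ∀ a b, LevelJoined s C a b → p a.2 a.1 = p b.2 b.1) _
      (by simp), ← (colouringEquiv n s C).symm.sum_comp]
  rfl

end

/-! ### Sums over colourings -/

section

variable {Q : Type*} [Fintype Q] [DecidableEq Q] {n : ℕ}

/-- Summing over the colours of all other pieces gives a constant factor. -/
theorem sum_colouring_one (a : Q) :
    ∃ m : ℕ, ∀ F : Fin n → ℂ, ∑ g : Q → Fin n, F (g a) = m * ∑ i, F i := by
  refine ⟨Fintype.card ({q : Q // q ≠ a} → Fin n), fun F => ?_⟩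
  rw [← (Equiv.funSplitAt a (Fin n)).symm.sum_comp, Fintype.sum_prod_type, Finset.mul_sum]
  refine Finset.sum_congr rfl fun i _ => ?_
  simp [Equiv.funSplitAt]

theorem sum_colouring_two {a b : Q} (hab : a ≠ b) :
    ∃ m : ℕ, ∀ F : Fin n → Fin n → ℂ,
      ∑ g : Q → Fin n, F (g a) (g b) = m * ∑ i, ∑ j, F i j := by
  obtain ⟨m, hm⟩ := sum_colouring_one (n := n) (⟨b, hab.symm⟩ : {q : Q // q ≠ a})
  refine ⟨m, fun F => ?_⟩
  rw [← (Equiv.funSplitAt a (Fin n)).symm.sum_comp, Fintype.sum_prod_type, Finset.mul_sum]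
  refine Finset.sum_congr rfl fun i _ => ?_
  rw [← hm]
  simp [Equiv.funSplitAt, hab.symm]

theorem generator_self (α α' i : Fin n) : generator α α' i i = 0 := by
  simp only [generator, Matrix.sub_apply, Matrix.single_apply]
  simp [and_comm]

theorem generator_swap (α α' i j : Fin n) : generator α α' j i = -generator α α' i j := by
  simp only [generator, Matrix.sub_apply, Matrix.single_apply, neg_sub]
  simp [and_comm]

theorem sum_generator_sq {α α' : Fin n} (h : α ≠ α') :
    ∑ i, ∑ j, generator α α' i j * generator α α' i j = 2 := by
  have h1 (i j : Fin n) : generator α α' i j * generator α α' i j =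
      (if α = i then if α' = j then 1 else 0 else 0) +
        (if α' = i then if α = j then 1 else 0 else 0) := by
    simp only [generator, Matrix.sub_apply, Matrix.single_apply]
    by_cases h1 : α = i <;> by_cases h2 : α' = j <;> by_cases h3 : α' = i <;>
      by_cases h4 : α = j <;> simp_all
  simp only [h1, Finset.sum_add_distrib]
  simp
  norm_num

theorem sum_generator_mul_generator_swap {α α' : Fin n} (h : α ≠ α') :
    ∑ i, ∑ j, generator α α' i j * generator α α' j i = -2 := by
  rw [← sum_generator_sq h, ← Finset.sum_neg_distrib]
  refine Finset.sum_congr rfl fun i _ => ?_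
  rw [← Finset.sum_neg_distrib]
  refine Finset.sum_congr rfl fun j _ => ?_
  rw [generator_swap α α' i j]; ring

/-- The sum over all colourings of the pieces of loops that end at two cut sites: `a`, `b` and `c`,
`d` are the pieces that end at the top and the bottom of the first and of the second site. The last
sum counts the colourings of the loops that result when the cuts are glued. -/
theorem sum_generator_mul_generator {α α' : Fin n} (h : α ≠ α') {a b c d : Q}
    (hp : (a = b ∧ c = d) ∨ (a = d ∧ b = c) ∨ (a = c ∧ b = d)) :
    n * ∑ g : Q → Fin n, generator α α' (g b) (g a) * generator α α' (g d) (g c) =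
      2 * ((if a = c then 1 else 0) - (if a = d then 1 else 0)) *
        ∑ g : Q → Fin n, (if g b = g a ∧ g d = g c then (1 : ℂ) else 0) := by
  have hdiag : ∑ i : Fin n, ∑ j : Fin n, (if i = j then (1 : ℂ) else 0) = n := by simp
  -- If `a = b`, then `c = d` as well: the left side vanishes as `L` has no diagonal, and the two
  -- indicators cancel.
  by_cases hab : a = b
  · subst hab
    have hcd : c = d := by
      rcases hp with h | ⟨h1, h2⟩ | ⟨h1, h2⟩
      · exact h.2
      · rw [← h2, h1]
      · rw [← h1, h2]
    subst hcd
    simp [generator_self]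
  · rcases hp with ⟨h1, -⟩ | ⟨rfl, rfl⟩ | ⟨rfl, rfl⟩
    · exact absurd h1 hab
    · obtain ⟨m, hm⟩ := sum_colouring_two (n := n) hab
      have e1 := hm fun i j => generator α α' j i * generator α α' i j
      have e2 := hm fun i j => if j = i ∧ i = j then 1 else 0
      have h3 (i j : Fin n) : (j = i ∧ i = j) ↔ i = j := ⟨And.right, fun h => ⟨h.symm, h⟩⟩
      simp only [h3] at e2
      simp only [h3, e1, e2, hdiag]
      rw [Finset.sum_comm, sum_generator_mul_generator_swap h, if_neg hab, if_pos trivial]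
      ring
    · obtain ⟨m, hm⟩ := sum_colouring_two (n := n) hab
      have e1 := hm fun i j => generator α α' j i * generator α α' j i
      have e2 := hm fun i j => if j = i ∧ j = i then 1 else 0
      have h3 (i j : Fin n) : (j = i ∧ j = i) ↔ i = j :=
        ⟨fun h => h.1.symm, fun h => ⟨h.symm, h.symm⟩⟩
      simp only [h3] at e2
      simp only [h3, e1, e2, hdiag]
      rw [Finset.sum_comm, sum_generator_sq h, if_neg hab, if_pos trivial]
      ring

theorem sum_generator_mul_self {α α' : Fin n} (h : α ≠ α') (a : Q) :
    n * ∑ g : Q → Fin n, (generator α α' * generator α α') (g a) (g a) =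
      -2 * ∑ _g : Q → Fin n, (1 : ℂ) := by
  obtain ⟨m, hm⟩ := sum_colouring_one (n := n) a
  have e1 := hm fun i => (generator α α' * generator α α') i i
  have e2 := hm fun _ => 1
  rw [e1, e2]
  simp only [Matrix.mul_apply, sum_generator_mul_generator_swap h]
  simp
  ring

end

/-! ### Parity -/

/-- If each set of pieces contains an even number of the four ends, then the ends lie pairwise on
common pieces. -/
theorem pairing_of_parity {Q : Type*} [DecidableEq Q] {a b c d : Q}
    (h : ∀ f : Q → ZMod 2, f c + f a = f d + f b) :
    (a = b ∧ c = d) ∨ (a = d ∧ b = c) ∨ (a = c ∧ b = d) := by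
  -- `ZMod 2`-valued functions separate points.
  have inj {p q : Q} (hpq : ∀ f : Q → ZMod 2, f p = f q) : p = q := by
    have := hpq (Pi.single q 1)
    rw [Pi.single_eq_same, Pi.single_apply] at this
    by_contra hne
    rw [if_neg hne] at this
    exact zero_ne_one this
  have ha : a = b ∨ a = c ∨ a = d := by
    by_contra! hne
    have := h (Pi.single a 1)
    simp [hne.1.symm, hne.2.1.symm, hne.2.2.symm] at this
  have key : ∀ p q r : ZMod 2, p + p = q + r → r = q := by decide
  rcases ha with rfl | rfl | rfl
  · exact Or.inl ⟨rfl, inj fun f => add_right_cancel (h f)⟩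
  · exact Or.inr (Or.inr ⟨rfl, inj fun f => key _ _ _ (h f)⟩)
  · exact Or.inr (Or.inl ⟨rfl, inj fun f => add_left_cancel ((h f).symm.trans (add_comm _ _))⟩)

section

variable {n ℓ k : ℕ} {s : Fin k → LinkType ℓ} {C : Set (Vertex ℓ)}

/-- A set of pieces of loops, given by its indicator, meets any two levels in the same number of
sites modulo `2`: a cross moves a piece to another site, and a double-bar creates or annihilates
two visited sites. -/
theorem sum_parity_level (f : Piece s C → ZMod 2) (j : Fin (k + 1)) :
    ∑ z, f (piece s C z j) = ∑ z, f (piece s C z 0) := by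
  induction j using Fin.induction with
  | zero => rfl
  | succ i ih =>
    rw [← ih, ← sub_eq_zero, ← Finset.sum_sub_distrib]
    have hs := Finset.sum_subset (Finset.subset_univ {(s i).1.left, (s i).1.right})
      (f := fun z => f (piece s C z i.succ) - f (piece s C z i.castSucc)) fun z _ hz => by
        simp only [Finset.mem_insert, Finset.mem_singleton, not_or] at hz
        rw [sub_eq_zero]
        exact congrArg f (Quot.sound (.straight i z hz.1 hz.2)).symm
    rw [← hs, Finset.sum_pair (Edge.left_ne_right _)]
    have key : ∀ a b : ZMod 2, a - b + (b - a) = 0 ∧ a - b + (a - b) = 0 := by decide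
    rcases hm : (s i).2 with _ | _
    · have h1 : piece s C (s i).1.left i.castSucc = piece s C (s i).1.right i.succ :=
        Quot.sound (.cross_left i hm)
      have h2 : piece s C (s i).1.right i.castSucc = piece s C (s i).1.left i.succ :=
        Quot.sound (.cross_right i hm)
      rw [h1, h2]
      exact (key _ _).1
    · have h1 : piece s C (s i).1.left i.castSucc = piece s C (s i).1.right i.castSucc :=
        Quot.sound (.dbar_bottom i hm)
      have h2 : piece s C (s i).1.left i.succ = piece s C (s i).1.right i.succ :=
        Quot.sound (.dbar_top i hm)
      rw [h1, h2]
      exact (key _ _).2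

/-- The levels `0` and `k` of a piece agree off the cuts, so that its parities at the cuts agree. -/
theorem sum_parity_cut (f : Piece s C → ZMod 2) (S : Finset (Vertex ℓ)) (hS : ∀ z ∈ C, z ∈ S) :
    ∑ z ∈ S, f (piece s C z 0) = ∑ z ∈ S, f (piece s C z (Fin.last k)) := by
  have h := sum_parity_level f (Fin.last k)
  rw [← sub_eq_zero, ← Finset.sum_sub_distrib] at h ⊢
  rw [Finset.sum_subset (Finset.subset_univ S) fun z _ hz => ?_]
  · rw [← neg_eq_zero, ← Finset.sum_neg_distrib, ← h]
    exact Finset.sum_congr rfl fun z _ => neg_sub _ _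
  · rw [sub_eq_zero]
    exact congrArg f (Quot.sound (.close z fun hC => hz (hS z hC))).symm

/-- The four ends at two cut sites lie pairwise on common pieces of loops. -/
theorem piece_pairing {x y : Vertex ℓ} (hxy : x ≠ y) :
    (piece s {x, y} x 0 = piece s {x, y} x (Fin.last k) ∧
        piece s {x, y} y 0 = piece s {x, y} y (Fin.last k)) ∨
      (piece s {x, y} x 0 = piece s {x, y} y (Fin.last k) ∧
        piece s {x, y} x (Fin.last k) = piece s {x, y} y 0) ∨
      (piece s {x, y} x 0 = piece s {x, y} y 0 ∧
        piece s {x, y} x (Fin.last k) = piece s {x, y} y (Fin.last k)) := by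
  refine pairing_of_parity fun f => ?_
  have := sum_parity_cut f {x, y} (by simp)
  rw [Finset.sum_pair hxy, Finset.sum_pair hxy] at this
  rw [add_comm, this, add_comm]

/-- The two ends at a single cut site lie on a common piece of a loop. -/
theorem piece_single (x : Vertex ℓ) :
    piece s {x, x} x 0 = piece s {x, x} x (Fin.last k) := by
  have := sum_parity_cut (Pi.single (piece s {x, x} x 0) 1) {x} (by simp)
  rw [Finset.sum_singleton, Finset.sum_singleton, Pi.single_eq_same, Pi.single_apply] at this
  by_contra h
  rw [if_neg (Ne.symm h)] at this
  exact one_ne_zero this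

open Classical in
/-- Gluing the cuts: the colourings of the pieces that agree across the cuts are the colourings of
the loops. -/
theorem sum_colouring_glue (n : ℕ) (s : Fin k → LinkType ℓ) (C : Set (Vertex ℓ)) :
    ∑ g : Piece s C → Fin n,
      (if ∀ z ∈ C, g (piece s C z (Fin.last k)) = g (piece s C z 0) then (1 : ℂ) else 0) =
      (n : ℂ) ^ Fintype.card (Piece s ∅) := by
  have h1 := sum_path_eq_sum_colouring (n := n) (s := s) (C := C) 1
    (fun σ τ => if ∀ z ∈ C, σ z = τ z then 1 else 0) fun σ τ => by
      simp only [Matrix.one_apply, funext_iff]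
      by_cases h1 : ∀ z ∈ C, σ z = τ z <;> by_cases h2 : ∀ z, z ∉ C → σ z = τ z
      · rw [if_pos h2, if_pos h1, if_pos fun z => (_root_.em (z ∈ C)).elim (h1 z) (h2 z)]
      · rw [if_neg h2, if_neg fun h => h2 fun z _ => h z]
      · rw [if_pos h2, if_neg h1, if_neg fun h => h1 fun z _ => h z]
      · rw [if_neg h2, if_neg fun h => h2 fun z _ => h z]
  have h2 := sum_path_eq_sum_colouring (n := n) (s := s) (C := ∅) 1
    (fun σ τ => 1) fun σ τ => by simp [Matrix.one_apply, funext_iff]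
  rw [← h1, h2]
  simp

end

/-! ### Spin operators -/

section

variable {n ℓ : ℕ}

open Classical in
theorem atSite_mul_atSite_of_ne (A B : Matrix (Fin n) (Fin n) ℂ) {x y : Vertex ℓ} (hxy : x ≠ y)
    (σ τ : Vertex ℓ → Fin n) : (atSite A x * atSite B y) σ τ =
      if ∀ z, z ∉ ({x, y} : Set (Vertex ℓ)) → σ z = τ z then A (σ x) (τ x) * B (σ y) (τ y)
        else 0 := by
  rw [Matrix.mul_apply, Finset.sum_eq_single (Function.update σ x (τ x))]
  · have h1 : ∀ z, z ≠ x → σ z = Function.update σ x (τ x) z := fun z hz => by simp [hz]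
    have h2 : (∀ z, z ≠ y → Function.update σ x (τ x) z = τ z) ↔
        ∀ z, z ∉ ({x, y} : Set (Vertex ℓ)) → σ z = τ z := by
      refine forall_congr' fun z => ?_
      by_cases hz : z = x
      · subst hz; simp
      · simp [hz]
    simp only [atSite, Matrix.of_apply]
    rw [if_pos h1, Function.update_self, Function.update_of_ne hxy.symm]
    simp only [h2, mul_ite, mul_zero]
  · intro ρ _ hρ
    simp only [atSite, Matrix.of_apply]
    by_cases h1 : ∀ z, z ≠ x → σ z = ρ z
    · rw [if_neg (c := ∀ z, z ≠ y → ρ z = τ z), mul_zero]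
      intro h2
      refine hρ (funext fun z => ?_)
      by_cases hz : z = x
      · subst hz; simp [h2 z hxy]
      · simp [hz, h1 z hz]
    · rw [if_neg h1, zero_mul]
  · simp

open Classical in
theorem atSite_mul_atSite_self (A B : Matrix (Fin n) (Fin n) ℂ) (x : Vertex ℓ)
    (σ τ : Vertex ℓ → Fin n) : (atSite A x * atSite B x) σ τ =
      if ∀ z, z ∉ ({x, x} : Set (Vertex ℓ)) → σ z = τ z then (A * B) (σ x) (τ x) else 0 := by
  rw [Matrix.mul_apply, Matrix.mul_apply, ← Fintype.sum_of_injective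
    (fun i : Fin n => Function.update σ x i) (Function.update_injective σ x)
    (fun i => if ∀ z, z ∉ ({x, x} : Set (Vertex ℓ)) → σ z = τ z then A (σ x) i * B i (τ x) else 0)]
  · split_ifs <;> simp
  · intro ρ hρ
    simp only [atSite, Matrix.of_apply]
    rw [if_neg, zero_mul]
    intro h
    refine hρ ⟨ρ x, funext fun z => ?_⟩
    by_cases hz : z = x
    · subst hz; simp
    · simp [hz, h z hz]
  · intro i
    simp only [atSite, Matrix.of_apply]
    have h1 : ∀ z, z ≠ x → σ z = Function.update σ x i z := fun z hz => by simp [hz]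
    have h2 : (∀ z, z ≠ x → Function.update σ x i z = τ z) ↔
        ∀ z, z ∉ ({x, x} : Set (Vertex ℓ)) → σ z = τ z := by
      refine forall_congr' fun z => ?_
      by_cases hz : z = x
      · subst hz; simp
      · simp [hz]
    rw [if_pos h1, Function.update_self]
    simp only [h2, mul_ite, mul_zero]

end

/-! ### The loop representation -/

section

variable {n ℓ : ℕ} {β : ℝ}

theorem Config.pow_numCross_mul_pow_numDbar (ω : Config ℓ β) (u : ℝ) :
    u ^ ω.numCross * ((n : ℝ)⁻¹) ^ ω.numDbar = ∏ l ∈ ω.links, linkCoeff n u l.2 := by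
  rw [← Finset.prod_filter_mul_prod_filter_not ω.links fun l => l.2 = Mark.cross]
  have h : ω.links.filter (fun l => ¬ l.2 = Mark.cross) =
      ω.links.filter fun l => l.2 = Mark.dbar := by
    refine Finset.filter_congr fun l _ => ?_
    cases l.2 <;> simp
  rw [h, numCross, numDbar, ← Finset.prod_const, ← Finset.prod_const]
  congr 1 <;> refine Finset.prod_congr rfl fun l hl => ?_ <;>
    rw [(Finset.mem_filter.mp hl).2, linkCoeff]

theorem LinkTuple.prod_links {k : ℕ} (v : LinkTuple ℓ β k) (F : Mark → ℝ) :
    ∏ l ∈ v.toConfig.links, F l.2 = ∏ i, F (types v.1 i).2 := by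
  simp only [LinkTuple.toConfig, Finset.prod_map]
  rfl

theorem abs_linkCoeff_le (hn : 1 ≤ n) (u : ℝ) (m : Mark) : |linkCoeff n u m| ≤ |u| + 1 := by
  have h1 : ((n : ℝ))⁻¹ ≤ 1 := inv_le_one_of_one_le₀ (by exact_mod_cast hn)
  cases m
  · simp [linkCoeff]
  · simp only [linkCoeff]
    rw [abs_of_nonneg (by positivity)]
    linarith [abs_nonneg u]

/-- The loop expansion of `Tr W e^{-2βH}`, given that the value of `f` at a configuration with links
of types `s` is `n^{-#double-bars}` times `g s`, and that the trace of `W` against the product of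
the link operators is a multiple of `g s`. -/
theorem trace_mul_exp_eq_integral (hn : 1 ≤ n) (hβ : 0 < β) (u : ℝ) (W : Operator n ℓ)
    (f : Config ℓ β → ℝ) (g : ∀ k, (Fin k → LinkType ℓ) → ℝ) (c : ℝ)
    (hf : ∀ k (v : LinkTuple ℓ β k), InOrder v.1 →
      f v.toConfig = g k (types v.1) * ((n : ℝ)⁻¹) ^ v.toConfig.numDbar)
    (hg : ∀ k s, |g k s| ≤ (n : ℝ) ^ (Fintype.card (Vertex ℓ) * (k + 1)))
    (hW : ∀ k (s : Fin k → LinkType ℓ), ∑ p : Fin (k + 1) → Vertex ℓ → Fin n,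
      W (p (Fin.last k)) (p 0) * ∏ i, linkOperator n (s i) (p i.castSucc) (p i.succ) =
        ((c * g k s : ℝ) : ℂ)) :
    (rho ℓ β u).Integrable f ∧
      Matrix.trace (W * NormedSpace.exp ((-2 * (β : ℂ)) • hamiltonian n ℓ u)) =
        ((c * (Real.exp (2 * β * (1 + u) * Fintype.card (Edge ℓ)) *
          ∫ᵛ ω, f ω ∂<•(rho ℓ β u)) : ℝ) : ℂ) := by
  have hcoeff (m : ℕ) (hm : 1 ≤ m) (u : ℝ) (k : ℕ) (s : Fin k → LinkType ℓ) :
      |∏ i, linkCoeff m u (s i).2| ≤ (|u| + 1) ^ k := by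
    rw [Finset.abs_prod]
    exact (Finset.prod_le_prod (fun _ _ => abs_nonneg _)
      fun i _ => abs_linkCoeff_le hm u (s i).2).trans_eq (by simp)
  -- The density `u ^ #crosses` of the signed measure.
  have hw := HasOrderedValue.hasSum_integral hβ (f := fun ω : Config ℓ β => u ^ ω.numCross)
    (G := fun k s => ∏ i, linkCoeff 1 u (s i).2) (fun k v _ => by
      simp only
      rw [← LinkTuple.prod_links, ← Config.pow_numCross_mul_pow_numDbar]; simp)
    1 (|u| + 1) (fun k s => by simpa using hcoeff 1 le_rfl u k s)
  have hval (u : ℝ) : HasOrderedValue (fun ω : Config ℓ β => f ω * u ^ ω.numCross)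
      (fun k s => (∏ i, linkCoeff n u (s i).2) * g k s) := fun k v hv => by
    simp only
    rw [hf k v hv, ← LinkTuple.prod_links, ← Config.pow_numCross_mul_pow_numDbar]
    ring
  have hfw := (hval u).hasSum_integral hβ ((n : ℝ) ^ Fintype.card (Vertex ℓ))
    ((|u| + 1) * (n : ℝ) ^ Fintype.card (Vertex ℓ)) (fun k s => by
      rw [abs_mul]
      calc _ ≤ (|u| + 1) ^ k * (n : ℝ) ^ (Fintype.card (Vertex ℓ) * (k + 1)) :=
            mul_le_mul (hcoeff n hn u k s) (hg k s) (abs_nonneg _) (by positivity)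
        _ = _ := by rw [mul_pow, ← pow_mul, mul_add, pow_add]; ring)
  have hmeas : AEStronglyMeasurable f (configMeasure ℓ β) := by
    simpa using (hval 1).aestronglyMeasurable
  refine ⟨integrable_smul_withDensityᵥ _ hmeas hw.1 hfw.1, ?_⟩
  have hsum := hasSum_trace_mul_exp W (-hamiltonian n ℓ u) (2 * β)
  have hexp : (2 * (β : ℂ)) • -hamiltonian n ℓ u = (-2 * (β : ℂ)) • hamiltonian n ℓ u := by
    rw [smul_neg, ← neg_smul, neg_mul]
  rw [hexp] at hsum
  have hsum' := (Complex.hasSum_ofReal.mpr hfw.2).mul_left (c : ℂ)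
  have hterm (k : ℕ) : (2 * (β : ℂ)) ^ k / k ! * Matrix.trace (W * (-hamiltonian n ℓ u) ^ k) =
      c * ((((2 * β) ^ k / k ! * ∑ s : Fin k → LinkType ℓ,
        (∏ i, linkCoeff n u (s i).2) * g k s : ℝ)) : ℂ) := by
    rw [neg_hamiltonian, trace_mul_pow_sum]
    simp only [hW]
    push_cast
    rw [mul_left_comm, Finset.mul_sum _ _ (c : ℂ)]
    congr 1
    exact Finset.sum_congr rfl fun s _ => by ring
  rw [funext hterm] at hsum
  have hnorm (I : ℝ) : Real.exp (2 * β * (1 + u) * Fintype.card (Edge ℓ)) *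
      (Real.exp (-((1 + u) * (2 * β) * Fintype.card (Edge ℓ))) * I) = I := by
    rw [← mul_assoc, ← Real.exp_add, show 2 * β * (1 + u) * (Fintype.card (Edge ℓ) : ℝ) +
      -((1 + u) * (2 * β) * Fintype.card (Edge ℓ)) = 0 by ring, Real.exp_zero, one_mul]
  rw [hsum.unique hsum', rho, rhoBar, integral_smul_withDensityᵥ _ hmeas hw.1 hfw.1, hnorm,
    Complex.ofReal_mul]

theorem mem_cut_iff (t₀ : Time β) (ht₀ : t₀.1 = 0) (x y : Vertex ℓ) (p : Vertex ℓ × Time β) :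
    p ∈ ({(x, t₀), (y, t₀)} : Set (Vertex ℓ × Time β)) ↔
      p.1 ∈ ({x, y} : Set (Vertex ℓ)) ∧ p.2.1 = 0 := by
  have h : p.2.1 = 0 ↔ p.2 = t₀ := by rw [Subtype.ext_iff, ht₀]
  rw [h]
  simp only [Set.mem_insert_iff, Set.mem_singleton_iff, Prod.ext_iff]
  tauto

theorem numLoops_toConfig (hβ : 0 < β) {k : ℕ} {v : LinkTuple ℓ β k} (hv : InOrder v.1) :
    v.toConfig.numLoops = Fintype.card (Piece (types v.1) ∅) := by
  rw [Config.numLoops, Config.Loop, Nat.card_congr (loopEquiv (C := ∅) hv (by simp)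
    (t₀ := ⟨0, neg_lt_zero.mpr hβ, hβ⟩) rfl), Nat.card_eq_fintype_card]

theorem loopWeight_toConfig (hn : 1 ≤ n) (hβ : 0 < β) {k : ℕ} {v : LinkTuple ℓ β k}
    (hv : InOrder v.1) : loopWeight n v.toConfig =
      (n : ℝ) ^ Fintype.card (Piece (types v.1) ∅) * ((n : ℝ)⁻¹) ^ v.toConfig.numDbar := by
  have hn' : (n : ℝ) ≠ 0 := by exact_mod_cast (by omega : n ≠ 0)
  rw [loopWeight, numLoops_toConfig hβ hv, zpow_sub₀ hn', zpow_natCast, zpow_natCast, inv_pow,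
    div_eq_mul_inv]

theorem connectedOff_toConfig_iff {k : ℕ} {v : LinkTuple ℓ β k} (hv : InOrder v.1) {t₀ : Time β}
    (ht₀ : t₀.1 = 0) (x y : Vertex ℓ) (a b : End ℓ β) :
    v.toConfig.ConnectedOff {(x, t₀), (y, t₀)} a b ↔
      (Quot.mk _ (toLevel v.1 a) : Piece (types v.1) {x, y}) = Quot.mk _ (toLevel v.1 b) := by
  rw [Config.ConnectedOff, eqvGen_joined_iff hv (mem_cut_iff t₀ ht₀ x y) ht₀, ← Quot.eq]

/-- The difference of the indicators of `x ⟷⁻ y` and `x ⟷⁺ y`, in terms of the level graph: the top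
of a site at time `0` sits at level `0`, and its bottom at level `k`. -/
def connectionSign {k : ℕ} (s : Fin k → LinkType ℓ) (x y : Vertex ℓ) : ℝ :=
  (if x ≠ y ∧ piece s {x, y} x 0 = piece s {x, y} y 0 then 1 else 0) -
    if piece s {x, y} x 0 = piece s {x, y} y (Fin.last k) then 1 else 0

theorem twoPointWeight_toConfig (hn : 1 ≤ n) (hβ : 0 < β) {k : ℕ} {v : LinkTuple ℓ β k}
    (hv : InOrder v.1) {t₀ : Time β} (ht₀ : t₀.1 = 0) (x y : Vertex ℓ) :
    twoPointWeight n t₀ x y v.toConfig =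
      (n : ℝ) ^ Fintype.card (Piece (types v.1) ∅) * connectionSign (types v.1) x y *
        ((n : ℝ)⁻¹) ^ v.toConfig.numDbar := by
  classical
  have hminus : v.toConfig ∈ minusConnected t₀ x y ↔
      x ≠ y ∧ piece (types v.1) {x, y} x 0 = piece (types v.1) {x, y} y 0 := by
    refine and_congr_right' ?_
    rw [connectedOff_toConfig_iff hv ht₀, toLevel, toLevel, upLevel_zero hv ht₀]
  have hplus : v.toConfig ∈ plusConnected t₀ x y ↔
      piece (types v.1) {x, y} x 0 = piece (types v.1) {x, y} y (Fin.last k) := by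
    refine (connectedOff_toConfig_iff hv ht₀ _ _ _ _).trans ?_
    rw [toLevel, toLevel, upLevel_zero hv ht₀, downLevel_zero hv ht₀]
  rw [twoPointWeight, loopWeight_toConfig hn hβ hv, connectionSign, mul_right_comm,
    Set.indicator_apply, Set.indicator_apply]
  simp only [hminus, hplus, Pi.one_apply]

theorem card_piece_le {k : ℕ} (s : Fin k → LinkType ℓ) :
    Fintype.card (Piece s ∅) ≤ Fintype.card (Vertex ℓ) * (k + 1) :=
  (Fintype.card_le_of_surjective _ Quot.mk_surjective).trans_eq (by simp)

/-- The trace of `L_x L_y` against a product of link operators, with the link operators in the order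
in which the links are met. -/
theorem sum_path_generator {α α' : Fin n} (h : α ≠ α') {k : ℕ} (s : Fin k → LinkType ℓ)
    (x y : Vertex ℓ) :
    ∑ p : Fin (k + 1) → Vertex ℓ → Fin n,
      (atSite (generator α α') x * atSite (generator α α') y) (p (Fin.last k)) (p 0) *
        ∏ i, linkOperator n (s i) (p i.castSucc) (p i.succ) =
      ((2 / (n : ℝ) * ((n : ℝ) ^ Fintype.card (Piece s ∅) * connectionSign s x y) : ℝ) : ℂ) := by
  have hn : (n : ℂ) ≠ 0 := Nat.cast_ne_zero.mpr α.pos.ne'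
  have hglue := sum_colouring_glue n s {x, y}
  refine mul_left_cancel₀ hn (Eq.trans ?_ (?_ : 2 * ((connectionSign s x y : ℝ) : ℂ) *
    (n : ℂ) ^ Fintype.card (Piece s ∅) = _))
  · by_cases hxy : x = y
    · subst hxy
      rw [sum_path_eq_sum_colouring (C := {x, x}) _
        (fun σ τ => (generator α α' * generator α α') (σ x) (τ x)) fun σ τ =>
          (atSite_mul_atSite_self _ _ x σ τ).trans (by congr),
        ← hglue]
      simp only [← piece_single (s := s) x]
      rw [sum_generator_mul_self h]
      have h1 (g : Piece s {x, x} → Fin n) : ∀ z ∈ ({x, x} : Set (Vertex ℓ)),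
          g (piece s {x, x} z (Fin.last k)) = g (piece s {x, x} z 0) := by
        intro z hz
        obtain rfl : z = x := by simpa using hz
        rw [piece_single]
      simp only [connectionSign, ← piece_single (s := s) x, if_pos (h1 _)]
      simp
    · rw [sum_path_eq_sum_colouring (C := {x, y}) _
        (fun σ τ => generator α α' (σ x) (τ x) * generator α α' (σ y) (τ y))
        fun σ τ =>
          (atSite_mul_atSite_of_ne _ _ hxy σ τ).trans (by congr), ← hglue,
        sum_generator_mul_generator h (piece_pairing hxy)]
      simp [connectionSign, hxy, apply_ite Complex.ofReal]
  · push_cast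
    field_simp

end

end SpinLoop

end

theorem theorem2p1 (n : ℕ) (hn : 2 ≤ n) (ℓ : ℕ) (β : ℝ) (hβ : 0 < β) (u : ℝ) :
    ((rho ℓ β u).Integrable (fun ω => loopWeight n ω) ∧
      Matrix.trace (NormedSpace.exp ((-2 * (β : ℂ)) • hamiltonian n ℓ u)) =
        ((Real.exp (2 * β * (1 + u) * Fintype.card (Edge ℓ)) *
          partitionFunction ℓ β n u : ℝ) : ℂ)) ∧
    (∀ α α' : Fin n, α < α' → ∀ x y : Vertex ℓ,
      (rho ℓ β u).Integrable
        (fun ω => twoPointWeight n ⟨0, neg_lt_zero.mpr hβ, hβ⟩ x y ω) ∧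
      Matrix.trace (atSite (generator α α') x * atSite (generator α α') y *
          NormedSpace.exp ((-2 * (β : ℂ)) • hamiltonian n ℓ u)) =
        ((2 / (n : ℝ) * Real.exp (2 * β * (1 + u) * Fintype.card (Edge ℓ)) *
          ∫ᵛ ω, twoPointWeight n ⟨0, neg_lt_zero.mpr hβ, hβ⟩ x y ω ∂<•(rho ℓ β u) : ℝ) : ℂ)) := by
  have hn1 : 1 ≤ n := by omega
  have hn1' : (1 : ℝ) ≤ n := by exact_mod_cast hn1
  have hpow (k : ℕ) (s : Fin k → LinkType ℓ) : (n : ℝ) ^ Fintype.card (Piece s ∅) ≤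
      (n : ℝ) ^ (Fintype.card (Vertex ℓ) * (k + 1)) :=
    pow_le_pow_right₀ hn1' (card_piece_le s)
  constructor
  · have h := trace_mul_exp_eq_integral hn1 hβ u 1 (loopWeight n)
      (fun k s => (n : ℝ) ^ Fintype.card (Piece s ∅)) 1
      (fun k v hv => loopWeight_toConfig hn1 hβ hv)
      (fun k s => by rw [abs_of_nonneg (by positivity)]; exact hpow k s)
      (fun k s => by
        rw [sum_path_eq_sum_colouring (C := ∅) _ (fun _ _ => 1) fun σ τ => by
          rw [Matrix.one_apply]
          split_ifs <;> simp_all [funext_iff]]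
        simp)
    rw [one_mul, one_mul] at h
    exact h
  · intro α α' hα x y
    have h := trace_mul_exp_eq_integral hn1 hβ u
      (atSite (generator α α') x * atSite (generator α α') y)
      (twoPointWeight n ⟨0, neg_lt_zero.mpr hβ, hβ⟩ x y)
      (fun k s => (n : ℝ) ^ Fintype.card (Piece s ∅) * connectionSign s x y) (2 / (n : ℝ))
      (fun k v hv => twoPointWeight_toConfig hn1 hβ hv rfl x y)
      (fun k s => by
        rw [abs_mul, abs_of_nonneg (by positivity : 0 ≤ (n : ℝ) ^ Fintype.card (Piece s ∅))]
        refine (mul_le_of_le_one_right (by positivity) ?_).trans (hpow k s)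
        unfold connectionSign
        split_ifs <;> simp)
      (fun k s => sum_path_generator hα.ne s x y)
    rw [← mul_assoc] at h
    exact h
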